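/- **Setting.** Let $T\ge 1$, $d_0=1$, $d_1,\dots,d_T\in\mathbb N$. For $j=1,\dots,T$ let $f^{(j)}:\mathbb R^{d_j}\to\mathbb R^{d_{j-1}}$, let $F=f^{(1)}\circ\cdots\circ f^{(T)}$, let $\mathcal X\subseteq\mathbb R^{d_T}$, and let $\mathcal X^*$ be the set of minimizers of $F$ over $\mathcal X$. $\Pi_K$ denotes the Euclidean projection onto $K$. A sampling oracle produces, upon each query, a sample path $(\omega_1,\dots,\omega_T)$ with a fixed joint law (the levels may depend on each other), independently of the query and of all earlier queries, and returns sample values $f^{(j)}_{\omega_j}(\cdot)\in\mathbb R^{d_{j-1}}$ and noisy gradients $\nabla f^{(j)}_{\omega_j}(\cdot)\in\mathbb R^{d_j\times d_{j-1}}$ (for $j=T$ these are noisy (sub)gradients $\widetilde\nabla f^{(T)}_{\omega_T}$), all jointly measurable in the sample and the point. Write $$\widetilde\nabla F_\omega(x)=\widetilde\nabla f^{(T)}_{\omega_T}(x)\,\nabla f^{(T-1)}_{\omega_{T-1}}(f^{(T)}(x))\cdots\nabla f^{(1)}_{\omega_1}(f^{(2)}\circ\cdots\circ f^{(T)}(x)).$$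 **Assumptions.** There are positive constants $C_j,V_j,L_j,L_F,\lambda$ such that: 1. $f^{(1)},\dots,f^{(T-1)}$ are continuously differentiable, $f^{(T)}$ is continuous, $\mathcal X$ is closed and convex, $\mathcal X^*\neq\emptyset$. 2. For every $j$ and $x\in\mathbb R^{d_j}$, almost surely $\mathbb E[f^{(j)}_{\omega_j}(x)\mid\omega_1,\dots,\omega_{j-1}]=f^{(j)}(x)$. For every $x\in\mathcal X$, $\mathbb E[\widetilde\nabla F_\omega(x)]$ is a subgradient of $F$ on $\mathcal X$ at $x$, i.e. $F(z)\ge F(x)+\langle \mathbb E[\widetilde\nabla F_\omega(x)],z-x\rangle$ for all $z\in\mathcal X$. 3. $f^{(T)}$ is $C_T$-Lipschitz. For $x\in\mathcal X$ and $p\in\{2,4\}$, almost surely $\mathbb E[\|\widetilde\nabla f^{(T)}_{\omega_T}(x)\|^p\mid\omega_1,\dots,\omega_{T-1}]\le C_T^{p/2}$ and $\mathbb E[\|f^{(T)}_{\omega_T}(x)-f^{(T)}(x)\|^p\mid\omega_1,\dots,\omega_{T-1}]\le V_T^{p/2}$. 4. For $j<T$: $\nabla f^{(j)}$ is $L_j$-Lipschitz;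 almost surely $\nabla f^{(j)}_{\omega_j}$ is the gradient of $f^{(j)}_{\omega_j}$ and is $L_j$-Lipschitz; and for all $x\in\mathbb R^{d_j}$ and $p\in\{2,4\}$, almost surely $\mathbb E[\|\nabla f^{(j)}_{\omega_j}(x)\|^p\mid\omega_1,\dots,\omega_{j-1}]\le C_j^{p/2}$ and $\mathbb E[\|f^{(j)}_{\omega_j}(x)-f^{(j)}(x)\|^p\mid\omega_1,\dots,\omega_{j-1}]\le V_j^{p/2}$. 5. $F$ is differentiable and $F(z)-F(x)\le\langle\nabla F(x),z-x\rangle+\frac{L_F}{2}\|z-x\|^2$ for all $x,z$. 6. $F$ is convex on $\mathcal X$ and optimally strongly convex: $F(x)-F(\Pi_{\mathcal X^*}(x))\ge\lambda\|x-\Pi_{\mathcal X^*}(x)\|^2$ for all $x\in\mathcal X$. **Algorithm (a-TSCGD).** Start from an arbitrary deterministic point $(x_0,y_0^{(T-1)},\dots,y_0^{(1)})$ with $x_0\in\mathcal X$, and write $y_k^{(T)}=x_k$. In iteration $k=0,1,\dots$: $$x_{k+1}=\Pi_{\mathcal X}\Big\{x_k-\alpha_k\widetilde\nabla f^{(T)}_{\omega_T}(x_k)\nabla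 f^{(T-1)}_{\omega_{T-1}}(y_k^{(T-1)})\cdots\nabla f^{(1)}_{\omega_1}(y_k^{(1)})\Big\}$$ with one sample path; then, for $j=T-1,\dots,1$ in this order, with a new query (a fresh sample path) for each $j$, $$\widehat y^{(j)}_{k+1}=\Big(1-\tfrac1{\beta_{j,k}}\Big)y^{(j+1)}_k+\tfrac1{\beta_{j,k}}y^{(j+1)}_{k+1},\qquad y^{(j)}_{k+1}=(1-\beta_{j,k})y^{(j)}_k+\beta_{j,k}f^{(j+1)}_{\omega_{j+1}}(\widehat y^{(j)}_{k+1}),$$ except that in the *basic variant* the step $j=T-1$ is $y^{(T-1)}_{k+1}=(1-\beta_{T-1,k})y^{(T-1)}_k+\beta_{T-1,k}f^{(T)}_{\omega_T}(x_{k+1})$. The *smooth variant* uses the extrapolated step for $j=T-1$ as well. Below, stepsize formulas hold for $k\ge1$; $\alpha_0$ and $\beta_{j,0}$ are arbitrary positive numbers. **Theorem 3.3 (Convergence rate of a-TSCGD for strongly convex problems).** In all cases below the expectations are finite, and the bounds hold for all $n\ge 1$ with a constant independent of $n$. (a) Let $a\le 1$ and $b_1,\dots,b_{T-1}$ be real numbers,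 $\alpha_k=\frac1\lambda k^{-a}$, $\beta_{T-1,k}=k^{-b_{T-1}}$ and $\beta_{j,k}=2k^{-b_j}$ for $1\le j\le T-2$. Then the basic variant satisfies $$\mathbb E\big[\|x_n-\Pi_{\mathcal X^*}(x_n)\|^2\big]=\mathcal O\Big(n^{-a}+n^{-2(a-b_{T-1})}+n^{-b_{T-1}}+\sum_{j=1}^{T-2}\big[n^{-4(b_{j+1}-b_j)}+n^{-b_j}\big]\Big)$$ (for $T=1$ the right-hand side is $\mathcal O(n^{-a})$). (b) With $a=1$ and $b_j=\frac{3+j}{4+T}$ for $j=1,\dots,T-1$ in (a), the basic variant satisfies $$\mathbb E\big[\|x_n-\Pi_{\mathcal X^*}(x_n)\|^2\big]=\mathcal O\big(n^{-4/(4+T)}\big).$$ (c) Suppose in addition that $f^{(T)}$ is differentiable with $L_T$-Lipschitz gradient on $\mathbb R^{d_T}$ and that the bounds on $f^{(T)}_{\omega_T}(x)-f^{(T)}(x)$ in 3 hold for all $x\in\mathbb R^{d_T}$. With $\alpha_k=\frac1\lambda k^{-1}$ and $\beta_{j,k}=2k^{-(3+j)/(3+T)}$ for $j=1,\dots,T-1$,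 the smooth variant satisfies $$\mathbb E\big[\|x_n-\Pi_{\mathcal X^*}(x_n)\|^2\big]=\mathcal O\big(n^{-4/(3+T)}\big).$$ -/

import Mathlib

open MeasureTheory ProbabilityTheory
open scoped RealInnerProductSpace

noncomputable section

namespace TSCGD

/-- The dimensions `d₀ = 1, d₁, d₂, …` of the spaces between the levels. -/
def dim (d : ℕ → ℕ) : ℕ → ℕ
  | 0 => 1
  | j + 1 => d (j + 1)

/-- The space `ℝ^{d_j}`, with `ℝ^{d_0} = ℝ¹`. -/
abbrev E (d : ℕ → ℕ) (j : ℕ) : Type := EuclideanSpace ℝ (Fin (dim d j))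

/-- The unit vector of `ℝ^{d_0} = ℝ¹`. -/
def unitVec (d : ℕ → ℕ) : E d 0 :=
  (EuclideanSpace.single (0 : Fin 1) (1 : ℝ) : EuclideanSpace ℝ (Fin 1))

/-- A sample path. The coordinate with index `j` is the random variable `ω_{j+1}` of level `j + 1`.
For a problem with `T` levels only the coordinates `0, …, T - 1` are ever read. -/
abbrev SamplePath (W : ℕ → Type*) := ∀ j : ℕ, W j

/-- The data of a multi-level stochastic compositional problem and of its sampling oracle.
The index `j` stands for level `j + 1`: `f j` is the component function
`f^{(j+1)} : ℝ^{d_{j+1}} → ℝ^{d_j}`, `value j ω` is the sample function `f_ω^{(j+1)}`, and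
`grad j ω x` is the noisy gradient of level `j + 1` at `x`, a `d_{j+1} × d_j` matrix
(the transpose of a Jacobian), seen as a linear map `ℝ^{d_j} → ℝ^{d_{j+1}}`. -/
structure Oracle (d : ℕ → ℕ) (W : ℕ → Type*) [∀ j, MeasurableSpace (W j)] where
  f : ∀ j, E d (j + 1) → E d j
  value : ∀ j, W j → E d (j + 1) → E d j
  grad : ∀ j, W j → E d (j + 1) → (E d j →L[ℝ] E d (j + 1))
  measurable_value : ∀ j, Measurable (Function.uncurry (value j))
  measurable_grad : ∀ j, Measurable (Function.uncurry (grad j))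

/-- A point of `K` nearest to `z`: the Euclidean projection `Π_K(z)` when `K` is a nonempty closed
convex set (see `proj_spec`, `proj_unique`). -/
def proj {V : Type*} [PseudoMetricSpace V] (K : Set V) (z : V) : V :=
  @Classical.epsilon V ⟨z⟩ (fun p => p ∈ K ∧ ∀ q ∈ K, dist z p ≤ dist z q)

theorem proj_spec {n : ℕ} {K : Set (EuclideanSpace ℝ (Fin n))} (hne : K.Nonempty)
    (hc : IsClosed K) (z : EuclideanSpace ℝ (Fin n)) :
    proj K z ∈ K ∧ ∀ q ∈ K, dist z (proj K z) ≤ dist z q := by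
  obtain ⟨p, hp, hpz⟩ := hc.exists_infDist_eq_dist hne z
  have h : ∃ p, p ∈ K ∧ ∀ q ∈ K, dist z p ≤ dist z q :=
    ⟨p, hp, fun q hq => hpz ▸ Metric.infDist_le_dist_of_mem hq⟩
  exact Classical.epsilon_spec h

theorem proj_unique {n : ℕ} {K : Set (EuclideanSpace ℝ (Fin n))} (hc : IsClosed K)
    (hK : Convex ℝ K) {z p : EuclideanSpace ℝ (Fin n)} (hp : p ∈ K)
    (hmin : ∀ q ∈ K, dist z p ≤ dist z q) : proj K z = p := by
  obtain ⟨hq, hqmin⟩ := proj_spec ⟨p, hp⟩ hc z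
  set q := proj K z
  have heq : ‖z - p‖ = ‖z - q‖ := by
    rw [← dist_eq_norm, ← dist_eq_norm]; exact le_antisymm (hmin q hq) (hqmin p hp)
  have hm : (2⁻¹ : ℝ) • p + (2⁻¹ : ℝ) • q ∈ K :=
    hK hp hq (by norm_num) (by norm_num) (by norm_num)
  have h1 := hmin _ hm
  rw [dist_eq_norm, dist_eq_norm] at h1
  have h2 : z - ((2⁻¹ : ℝ) • p + (2⁻¹ : ℝ) • q) = (2⁻¹ : ℝ) • ((z - p) + (z - q)) := by module
  rw [h2, norm_smul, Real.norm_of_nonneg (by norm_num)] at h1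
  have h3 := parallelogram_law_with_norm ℝ (z - p) (z - q)
  have h4 : ‖(z - p) - (z - q)‖ = 0 := by
    have := norm_nonneg (z - p)
    have := norm_nonneg ((z - p) - (z - q))
    have h5 : 2 * ‖z - p‖ ≤ ‖z - p + (z - q)‖ := by linarith
    rw [← heq] at h3
    nlinarith
  rw [norm_eq_zero] at h4
  have h6 : (z - p) - (z - q) = q - p := by abel
  rw [h6] at h4
  exact sub_eq_zero.mp h4

section Defs

variable {d : ℕ → ℕ} {W : ℕ → Type*} [∀ j, MeasurableSpace (W j)]

/-- `comp j = f^{(1)} ∘ ⋯ ∘ f^{(j)} : ℝ^{d_j} → ℝ^{d_0}`. -/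
def comp (O : Oracle d W) : ∀ j, E d j → E d 0
  | 0, x => x
  | j + 1, x => comp O j (O.f j x)

/-- The objective `F = f^{(1)} ∘ ⋯ ∘ f^{(T)}`, a real function on `ℝ^{d_T}`. -/
def objective (O : Oracle d W) (T : ℕ) (x : E d T) : ℝ :=
  (comp O T x : EuclideanSpace ℝ (Fin 1)) (0 : Fin 1)

/-- `∇f_{ω_j}^{(j)}(x) ∇f_{ω_{j-1}}^{(j-1)}(f^{(j)}(x)) ⋯ ∇f_{ω_1}^{(1)}(f^{(2)} ∘ ⋯ ∘ f^{(j)}(x))`.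
For `j = T` this is the sample gradient `∇F_ω(x)` of the objective. -/
def gradSample (O : Oracle d W) (w : SamplePath W) : ∀ j, E d j → E d j
  | 0, _ => unitVec d
  | j + 1, x => O.grad j (w j) x (gradSample O w j (O.f j x))

/-- `∇f_{ω_j}^{(j)}(y^{(j)}) ∇f_{ω_{j-1}}^{(j-1)}(y^{(j-1)}) ⋯ ∇f_{ω_1}^{(1)}(y^{(1)})`,
the direction of the quasi-gradient step when `j = T` and `y^{(T)} = x`. -/
def quasiGrad (O : Oracle d W) (w : SamplePath W) (y : ∀ j, E d j) : ∀ j, E d j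
  | 0 => unitVec d
  | j + 1 => O.grad j (w j) (y (j + 1)) (quasiGrad O w y j)

/-- The σ-algebra of the random variables of the levels before the one with index `j`,
that is `σ(ω_1, …, ω_j)`. -/
abbrev lowerLevels (W : ℕ → Type*) [∀ j, MeasurableSpace (W j)] (j : ℕ) :
    MeasurableSpace (SamplePath W) :=
  ⨆ i, ⨆ (_ : i < j), MeasurableSpace.comap (fun w : SamplePath W => w i) inferInstance

theorem lowerLevels_le (j : ℕ) : lowerLevels W j ≤ MeasurableSpace.pi :=
  iSup₂_le fun i _ => (measurable_pi_apply i).comap_le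

/-- `𝔼[g | lower levels] ≤ c` almost surely, for an integrable `g`. -/
def CondBound (P : Measure (SamplePath W)) (j : ℕ) (g : SamplePath W → ℝ) (c : ℝ) : Prop :=
  Integrable g P ∧ ∀ᵐ w ∂P, (P[g | lowerLevels W j]) w ≤ c

/-- The set `𝒳*` of minimizers of `F` over `X`. -/
def optimalSet {V : Type*} (X : Set V) (F : V → ℝ) : Set V :=
  {x | x ∈ X ∧ ∀ z ∈ X, F x ≤ F z}

/-- The subgradients at `x` of the function `F` on the feasible set `X`. -/
def subgradients {V : Type*} [NormedAddCommGroup V] [InnerProductSpace ℝ V]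
    (X : Set V) (F : V → ℝ) (x : V) : Set V :=
  {g | ∀ z ∈ X, F x + ⟪g, z - x⟫ ≤ F z}

/-- `F` is optimally strongly convex on `X` with parameter `lam`. -/
def OptimallyStronglyConvex {V : Type*} [NormedAddCommGroup V] (X : Set V) (F : V → ℝ)
    (lam : ℝ) : Prop :=
  0 < lam ∧ ∀ x ∈ X,
    lam * ‖x - proj (optimalSet X F) x‖ ^ 2 ≤ F x - F (proj (optimalSet X F) x)

/-- `F` is differentiable and `F z - F x ≤ ⟨∇F x, z - x⟩ + (L_F / 2) ‖z - x‖²` for all `x`, `z`. -/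
def SmoothObjective {V : Type*} [NormedAddCommGroup V] [InnerProductSpace ℝ V] [CompleteSpace V]
    (F : V → ℝ) : Prop :=
  Differentiable ℝ F ∧ ∃ LF : ℝ, 0 < LF ∧
    ∀ x z, F z - F x ≤ ⟪gradient F x, z - x⟫ + LF / 2 * ‖z - x‖ ^ 2

/-- The basic assumptions on a problem with `T = N + 1` levels, feasible set `X`, law `P` of a
sample path and constants `C`, `V`, `L`. The index `N` is the innermost level `T`; the indices
`j < N` are the levels `1, …, T - 1`. -/
structure BasicAssumption (O : Oracle d W) (N : ℕ) (X : Set (E d (N + 1)))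
    (P : Measure (SamplePath W)) (C V L : ℕ → ℝ) : Prop where
  pos : ∀ j ≤ N, 0 < C j ∧ 0 < V j ∧ 0 < L j
  -- regularity of the problem, and existence of an optimal solution
  outer_contDiff : ∀ j < N, ContDiff ℝ 1 (O.f j)
  inner_continuous : Continuous (O.f N)
  closed : IsClosed X
  convex : Convex ℝ X
  exists_optimal : (optimalSet X (objective O (N + 1))).Nonempty
  -- conditional unbiasedness of the sample values
  value_integrable : ∀ j ≤ N, ∀ x, Integrable (fun w : SamplePath W => O.value j (w j) x) P
  value_unbiased : ∀ j ≤ N, ∀ x,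
    ∀ᵐ w ∂P, (P[fun w : SamplePath W => O.value j (w j) x | lowerLevels W j]) w = O.f j x
  -- the sample gradient of the objective is a subgradient in expectation
  grad_integrable : ∀ x ∈ X, Integrable (fun w : SamplePath W => gradSample O w (N + 1) x) P
  grad_unbiased : ∀ x ∈ X,
    (∫ w, gradSample O w (N + 1) x ∂P) ∈ subgradients X (objective O (N + 1)) x
  -- the innermost level
  inner_lipschitz : ∀ x z, ‖O.f N x - O.f N z‖ ≤ C N * ‖x - z‖
  inner_grad_bound : ∀ x ∈ X, CondBound P N (fun w => ‖O.grad N (w N) x‖ ^ 2) (C N)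
  inner_value_bound : ∀ x ∈ X,
    CondBound P N (fun w => ‖O.value N (w N) x - O.f N x‖ ^ 2) (V N)
  -- the other levels: Lipschitz gradients of the component functions and of the samples
  outer_smooth : ∀ j < N, ∀ x z, ‖fderiv ℝ (O.f j) x - fderiv ℝ (O.f j) z‖ ≤ L j * ‖x - z‖
  outer_grad : ∀ j < N, ∀ᵐ w ∂P, ∀ x,
    HasFDerivAt (O.value j (w j)) (ContinuousLinearMap.adjoint (O.grad j (w j) x)) x
  outer_sample_smooth : ∀ j < N, ∀ᵐ w ∂P, ∀ x z,
    ‖O.grad j (w j) x - O.grad j (w j) z‖ ≤ L j * ‖x - z‖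
  outer_grad_bound : ∀ j < N, ∀ x, CondBound P j (fun w => ‖O.grad j (w j) x‖ ^ 2) (C j)
  outer_value_bound : ∀ j < N, ∀ x,
    CondBound P j (fun w => ‖O.value j (w j) x - O.f j x‖ ^ 2) (V j)

/-- Bounded conditional fourth moments of the samples. -/
structure FourthMomentAssumption (O : Oracle d W) (N : ℕ) (X : Set (E d (N + 1)))
    (P : Measure (SamplePath W)) (C V : ℕ → ℝ) : Prop where
  inner_grad_bound : ∀ x ∈ X, CondBound P N (fun w => ‖O.grad N (w N) x‖ ^ 4) (C N ^ 2)
  inner_value_bound : ∀ x ∈ X,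
    CondBound P N (fun w => ‖O.value N (w N) x - O.f N x‖ ^ 4) (V N ^ 2)
  outer_grad_bound : ∀ j < N, ∀ x, CondBound P j (fun w => ‖O.grad j (w j) x‖ ^ 4) (C j ^ 2)
  outer_value_bound : ∀ j < N, ∀ x,
    CondBound P j (fun w => ‖O.value j (w j) x - O.f j x‖ ^ 4) (V j ^ 2)

/-- The innermost component function has a Lipschitz continuous gradient. The algorithm then queries
the innermost level at extrapolated points, which need not be feasible; so this, and the bound on
the noise of the innermost sample values, is required on the whole space. -/
structure SmoothInnerAssumption (O : Oracle d W) (N : ℕ) (P : Measure (SamplePath W)) (V L : ℕ → ℝ) :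
    Prop where
  differentiable : Differentiable ℝ (O.f N)
  smooth : ∀ x z, ‖fderiv ℝ (O.f N) x - fderiv ℝ (O.f N) z‖ ≤ L N * ‖x - z‖
  value_bound : ∀ x, CondBound P N (fun w => ‖O.value N (w N) x - O.f N x‖ ^ 2) (V N)
  value_bound_four : ∀ x, CondBound P N (fun w => ‖O.value N (w N) x - O.f N x‖ ^ 4) (V N ^ 2)

/-- The sample paths generated by the oracle. `s k j` is the path generated upon the query that is
made in iteration `k` for updating `y^{(j)}`, for `1 ≤ j ≤ T`, where `y^{(T)} = x`. Each query
yields an independent path with law `P`; the levels within one path may depend on each other. -/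
structure SamplePaths {Ω : Type*} [MeasurableSpace Ω] (μ : Measure Ω) (T : ℕ)
    (P : Measure (SamplePath W)) (s : ℕ → ℕ → Ω → SamplePath W) : Prop where
  measurable : ∀ k, ∀ j ∈ Set.Icc 1 T, Measurable (s k j)
  law : ∀ k, ∀ j ∈ Set.Icc 1 T, μ.map (s k j) = P
  indep : iIndepFun (fun q : ℕ × Set.Icc 1 T => s q.1 q.2) μ

/-- The extrapolated point `(1 - 1/β) u + (1/β) v`. -/
def extrapolate {V : Type*} [AddCommGroup V] [Module ℝ V] (β : ℝ) (u v : V) : V :=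
  (1 - 1 / β) • u + (1 / β) • v

/-- `y` is the process generated by the accelerated stochastic compositional gradient method with
`T = N + 1` levels, started at a deterministic point `(x_0, y_0^{(T-1)}, …, y_0^{(1)})` with
`x_0 ∈ X`. Here `y j k` is `y_k^{(j)}` for `1 ≤ j ≤ T`, and `y (N + 1) k = y_k^{(T)}` is the main
iterate `x_k`. The innermost level is updated with extrapolation if `smoothInner` is `true`, and by
a basic update if it is `false`. -/
structure IsRun {Ω : Type*} (O : Oracle d W) (N : ℕ) (X : Set (E d (N + 1)))
    (s : ℕ → ℕ → Ω → SamplePath W) (smoothInner : Bool) (α : ℕ → ℝ) (β : ℕ → ℕ → ℝ)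
    (y : ∀ j, ℕ → Ω → E d j) : Prop where
  init : ∃ y₀ : ∀ j, E d j, y₀ (N + 1) ∈ X ∧ ∀ j ∈ Set.Icc 1 (N + 1), ∀ o, y j 0 o = y₀ j
  main : ∀ k o, y (N + 1) (k + 1) o =
    proj X (y (N + 1) k o
      - α k • quasiGrad O (s k (N + 1) o) (fun j => y j k o) (N + 1))
  basic : smoothInner = false → 1 ≤ N → ∀ k o, y N (k + 1) o =
    (1 - β N k) • y N k o + β N k • O.value N (s k N o N) (y (N + 1) (k + 1) o)
  accelerated : ∀ j, 1 ≤ j → (j < N ∨ (j = N ∧ smoothInner = true)) → ∀ k o, y j (k + 1) o =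
    (1 - β j k) • y j k o
      + β j k • O.value j (s k j o j)
          (extrapolate (β j k) (y (j + 1) k o) (y (j + 1) (k + 1) o))

/-- `𝔼 ‖x_n - Π_{𝒳*}(x_n)‖² = O(r n)` over `n ≥ 1`, where the expectations are finite. -/
def MeanSquareRate {Ω V : Type*} [MeasurableSpace Ω] [NormedAddCommGroup V] (μ : Measure Ω)
    (S : Set V) (x : ℕ → Ω → V) (r : ℕ → ℝ) : Prop :=
  ∃ K : ℝ, ∀ n : ℕ, 1 ≤ n → Integrable (fun o => ‖x n o - proj S (x n o)‖ ^ 2) μ ∧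
    ∫ o, ‖x n o - proj S (x n o)‖ ^ 2 ∂μ ≤ K * r n

/-- `n^{-a} + n^{-2(a - b_{T-1})} + n^{-b_{T-1}} + ∑_{j=1}^{T-2} (n^{-4(b_{j+1} - b_j)} + n^{-b_j})`
with `T = N + 1`; for `T = 1` there are no `b_j` and only the first term is present. -/
def generalRate (N : ℕ) (a : ℝ) (b : ℕ → ℝ) (n : ℕ) : ℝ :=
  (n : ℝ) ^ (-a) +
    if N = 0 then 0 else
      (n : ℝ) ^ (-(2 * (a - b N))) + (n : ℝ) ^ (-b N) +
        ∑ j ∈ Finset.Ico 1 N, ((n : ℝ) ^ (-(4 * (b (j + 1) - b j))) + (n : ℝ) ^ (-b j))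

/-- The stepsizes `α_k = k^{-a} / lam`, `β_{T-1,k} = c k^{-b_{T-1}}` and `β_{j,k} = 2 k^{-b_j}` for
`1 ≤ j ≤ T - 2`, where `T = N + 1` and `k ≥ 1`; the first stepsizes `α_0`, `β_{j,0}` are any positive
numbers. -/
structure PolynomialSteps (N : ℕ) (lam c a : ℝ) (b : ℕ → ℝ) (α : ℕ → ℝ) (β : ℕ → ℕ → ℝ) :
    Prop where
  alpha_zero : 0 < α 0
  beta_zero : ∀ j ∈ Set.Icc 1 N, 0 < β j 0
  alpha : ∀ k : ℕ, 1 ≤ k → α k = 1 / lam * (k : ℝ) ^ (-a)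
  beta_inner : 1 ≤ N → ∀ k : ℕ, 1 ≤ k → β N k = c * (k : ℝ) ^ (-b N)
  beta_outer : ∀ j ∈ Set.Ico 1 N, ∀ k : ℕ, 1 ≤ k → β j k = 2 * (k : ℝ) ^ (-b j)

end Defs

end TSCGD

end

open TSCGD

set_option linter.unusedSectionVars false

/-! Treat the main iterate as the level `N + 1` and write `e` for its displacement from its
projection onto the optimal set. Optimal strong convexity and the subgradient inequality give `⟪e, 𝔼
∇F_ω(x)⟫ ≥ lam ‖e‖²`. The direction actually used is biased, because it evaluates the outer
gradients at the tracked points `y j` instead of the exact inner values. The squared mean bias is at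
most a constant times the sum of the squared tracking errors `‖y j - f j (y (j + 1))‖²`
(`exists_bias`). Young's inequality spends a quarter of the contraction on this bias, so that one
step contracts `𝔼 ‖e‖²` by `1 - (3/2) lam α`, up to terms of order `α` times the tracking errors and
`α²` (`exists_main_step`). If the tracking errors are `O(k^{-q})` with `q ≤ a ≤ 1`, then
`rate_of_recursion` yields `𝔼 ‖e‖² = O(k^{-q})`. Here `3/2 > q` is what matters when `a = 1`.

The tracking error of one level satisfies: new error = `(1 - β)` old error + drift + `β` noise. The
noise is centered and the drift is the motion of the target that the query does not match. Without
extrapolation the drift is of first order in the increment of the level below. With extrapolation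
the linear terms cancel and it is at most a multiple of `(1 + 1/β)` times the squared increment.
This is why fourth moments of increments are needed. They are `O(α⁴)` for the main iterate, the
projection being nonexpansive. They pass from one level to the next as `O(β⁴)` because the fourth
moments of the tracking errors stay bounded (`exists_pow_four_bound`, `rate_diff`). A descending
induction over the levels (`rate_levels`) then gives every tracking error the rate `q`, provided `q`
is at most each stepsize exponent, four times each gap of consecutive exponents at an extrapolated
level, and twice the gap at a basic level.

Two forms of randomness are handled separately. Within one path the levels may be dependent, so
products of gradients are bounded by the tower property, one level at a time (`CondBound.mul`).
Between queries the paths are independent, so estimates are made for a frozen state and integrated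
by Fubini (`HasMeanLE.of_indepFun`). -/

namespace TSCGD

/-! ### Euclidean projections and the optimal set -/

section Projection

variable {n : ℕ} {K : Set (EuclideanSpace ℝ (Fin n))}

theorem inner_sub_proj_le (hne : K.Nonempty) (hc : IsClosed K) (hK : Convex ℝ K)
    (z : EuclideanSpace ℝ (Fin n)) {q : EuclideanSpace ℝ (Fin n)} (hq : q ∈ K) :
    ⟪z - proj K z, q - proj K z⟫ ≤ 0 := by
  obtain ⟨hp, hmin⟩ := proj_spec hne hc z
  refine (norm_eq_iInf_iff_real_inner_le_zero hK hp).1 ?_ q hq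
  have : Nonempty K := hne.to_subtype
  refine le_antisymm (le_ciInf fun w => ?_) (ciInf_le ⟨0, ?_⟩ (⟨proj K z, hp⟩ : K))
  · simpa [dist_eq_norm] using hmin w w.2
  · rintro _ ⟨w, rfl⟩
    exact norm_nonneg _

theorem norm_proj_sub_proj_le (hne : K.Nonempty) (hc : IsClosed K) (hK : Convex ℝ K)
    (z z' : EuclideanSpace ℝ (Fin n)) : ‖proj K z - proj K z'‖ ≤ ‖z - z'‖ := by
  have h1 := inner_sub_proj_le hne hc hK z (proj_spec hne hc z').1
  have h2 := inner_sub_proj_le hne hc hK z' (proj_spec hne hc z).1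
  set p := proj K z
  set p' := proj K z'
  have h3 : ⟪p - p', p - p'⟫ ≤ ⟪z - z', p - p'⟫ := by
    have e1 : ⟪z - z', p - p'⟫ - ⟪p - p', p - p'⟫
        = -(⟪z - p, p' - p⟫ + ⟪z' - p', p - p'⟫) := by
      simp only [inner_sub_left, inner_sub_right]
      ring
    linarith
  rw [real_inner_self_eq_norm_sq] at h3
  have h4 := real_inner_le_norm (z - z') (p - p')
  by_contra! h
  nlinarith [norm_nonneg (z - z'), norm_nonneg (p - p')]

theorem continuous_proj (hne : K.Nonempty) (hc : IsClosed K) (hK : Convex ℝ K) :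
    Continuous (proj K) :=
  (LipschitzWith.of_dist_le_mul (K := 1) fun z z' => by
    simpa [dist_eq_norm] using norm_proj_sub_proj_le hne hc hK z z').continuous

theorem proj_eq_self (hc : IsClosed K) {z : EuclideanSpace ℝ (Fin n)} (hz : z ∈ K) :
    proj K z = z := by
  have := (proj_spec ⟨z, hz⟩ hc z).2 z hz
  rw [dist_self] at this
  exact (dist_le_zero.1 this).symm

theorem norm_sub_proj_le (hne : K.Nonempty) (hc : IsClosed K) (z : EuclideanSpace ℝ (Fin n))
    {q : EuclideanSpace ℝ (Fin n)} (hq : q ∈ K) : ‖z - proj K z‖ ≤ ‖z - q‖ := by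
  simpa [dist_eq_norm] using (proj_spec hne hc z).2 q hq

theorem isClosed_optimalSet {F : EuclideanSpace ℝ (Fin n) → ℝ} (hc : IsClosed K)
    (hF : Continuous F) : IsClosed (optimalSet K F) := by
  have : optimalSet K F = K ∩ ⋂ z ∈ K, {x | F x ≤ F z} := by
    ext x; simp [optimalSet]
  rw [this]
  exact hc.inter (isClosed_biInter fun z _ => isClosed_le hF continuous_const)

/-- Convexity makes the projection onto the optimal set nonexpansive, hence continuous; the
distances to that set are then measurable functions of the iterates. -/
theorem convex_optimalSet {F : EuclideanSpace ℝ (Fin n) → ℝ} (hF : ConvexOn ℝ K F) :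
    Convex ℝ (optimalSet K F) := by
  intro x hx y hy s t hs ht hst
  refine ⟨hF.1 hx.1 hy.1 hs ht hst, fun z hz => (hF.2 hx.1 hy.1 hs ht hst).trans ?_⟩
  have h1 := mul_le_mul_of_nonneg_left (hx.2 z hz) hs
  have h2 := mul_le_mul_of_nonneg_left (hy.2 z hz) ht
  simp only [smul_eq_mul]
  calc s * F x + t * F y ≤ s * F z + t * F z := by linarith
    _ = F z := by rw [← add_mul, hst, one_mul]

end Projection

/-! ### Elementary inequalities for powers of norms -/

section Inequalities

variable {V : Type*} [NormedAddCommGroup V]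

/-- The linear term is kept exact, so that it vanishes in mean when `B` is centered noise. The cubic
term `4 ⟪A, B⟫ ‖B‖²` is split by Young into `2 ⟪A, B⟫² + 2 ‖B‖⁴`, and Cauchy-Schwarz bounds the
squared inner products. -/
theorem norm_add_pow_four_le_inner [InnerProductSpace ℝ V] (A B : V) :
    ‖A + B‖ ^ 4 ≤ ‖A‖ ^ 4 + 4 * ‖A‖ ^ 2 * ⟪A, B⟫ + 8 * ‖A‖ ^ 2 * ‖B‖ ^ 2 + 3 * ‖B‖ ^ 4 := by
  have h : ‖A + B‖ ^ 4 = (‖A‖ ^ 2 + 2 * ⟪A, B⟫ + ‖B‖ ^ 2) ^ 2 := by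
    rw [← norm_add_sq_real]; ring
  have h2 : ⟪A, B⟫ ^ 2 ≤ ‖A‖ ^ 2 * ‖B‖ ^ 2 := by
    have := abs_real_inner_le_norm A B
    rw [← sq_abs, ← mul_pow]
    gcongr
  rw [h]
  nlinarith [sq_nonneg (⟪A, B⟫ - ‖B‖ ^ 2), sq_nonneg ⟪A, B⟫]

/-- The vector is a convex combination of `x` and `r / β`. The old error keeps the full contraction
`1 - β`, and the drift `r` is charged `β (‖r‖ / β) ^ m`. -/
theorem norm_add_pow_le_convex [NormedSpace ℝ V] (m : ℕ) {β : ℝ} (h0 : 0 < β) (h1 : β ≤ 1)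
    (x r : V) :
    ‖(1 - β) • x + r‖ ^ m ≤ (1 - β) * ‖x‖ ^ m + β * (‖r‖ / β) ^ m := by
  have h := (convexOn_pow m).2 (norm_nonneg x) (div_nonneg (norm_nonneg r) h0.le)
    (sub_nonneg.2 h1) h0.le (by ring)
  simp only [smul_eq_mul] at h
  refine le_trans ?_ h
  gcongr
  refine (norm_add_le _ _).trans ?_
  rw [norm_smul, Real.norm_of_nonneg (sub_nonneg.2 h1), mul_div_cancel₀ _ h0.ne']

theorem norm_add_pow_four_le (x r : V) : ‖x + r‖ ^ 4 ≤ 8 * (‖x‖ ^ 4 + ‖r‖ ^ 4) := by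
  have h := pow_le_pow_left₀ (norm_nonneg _) (norm_add_le x r) 4
  have h2 := add_pow_le (norm_nonneg x) (norm_nonneg r) 4
  norm_num at h2
  linarith

end Inequalities

/-! ### Rates and bounds from scalar recursions -/

section Recursions

theorem exists_rate_of_eventually {u : ℕ → ℝ} {K q : ℝ} {k₀ : ℕ}
    (h : ∀ k, k₀ ≤ k → u k ≤ K * (k : ℝ) ^ (-q)) :
    ∃ K', ∀ k : ℕ, 1 ≤ k → u k ≤ K' * (k : ℝ) ^ (-q) := by
  refine ⟨|K| + ∑ i ∈ Finset.range k₀, |u i| * (i : ℝ) ^ q, fun k hk => ?_⟩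
  have hkp : (0 : ℝ) < k := by exact_mod_cast hk
  have hp : 0 < (k : ℝ) ^ (-q) := Real.rpow_pos_of_pos hkp _
  have hs : 0 ≤ ∑ i ∈ Finset.range k₀, |u i| * (i : ℝ) ^ q :=
    Finset.sum_nonneg fun i _ => by positivity
  rcases le_or_gt k₀ k with hk0 | hk0
  · refine (h k hk0).trans ?_
    gcongr
    linarith [le_abs_self K]
  · have h1 : |u k| * (k : ℝ) ^ q ≤ ∑ i ∈ Finset.range k₀, |u i| * (i : ℝ) ^ q :=
      Finset.single_le_sum (f := fun i : ℕ => |u i| * (i : ℝ) ^ q)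
        (fun i _ => by positivity) (Finset.mem_range.2 hk0)
    calc u k ≤ |u k| := le_abs_self _
      _ = |u k| * (k : ℝ) ^ q * (k : ℝ) ^ (-q) := by
        rw [mul_assoc, ← Real.rpow_add hkp]; simp
      _ ≤ _ := by gcongr; linarith [abs_nonneg K]

theorem rpow_neg_sub_succ_le {q x : ℝ} (hq : 0 < q) (hx : 0 < x) :
    x ^ (-q) - (x + 1) ^ (-q) ≤ q * x⁻¹ * x ^ (-q) := by
  -- Bernoulli's inequality for a negative exponent, from `log (1 + t) ≤ t` and `exp s ≥ 1 + s`.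
  have h : 1 + (-q) * x⁻¹ ≤ (1 + x⁻¹) ^ (-q) :=
by
    have hx' := inv_pos.2 hx
    have hl : Real.log (1 + x⁻¹) ≤ x⁻¹ := by
      linarith [Real.log_le_sub_one_of_pos (show 0 < 1 + x⁻¹ by positivity)]
    rw [Real.rpow_def_of_pos (by positivity)]
    nlinarith [Real.add_one_le_exp (Real.log (1 + x⁻¹) * -q)]
  have h2 : (x + 1) ^ (-q) = x ^ (-q) * (1 + x⁻¹) ^ (-q) := by
    rw [← Real.mul_rpow hx.le (by positivity), mul_add, mul_one, mul_inv_cancel₀ hx.ne']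
  have h3 : 0 < x ^ (-q) := Real.rpow_pos_of_pos hx _
  rw [h2]
  nlinarith

theorem eventually_mul_rpow_neg_le (c : ℝ) {p ε : ℝ} (hp : 0 < p) (hε : 0 < ε) :
    ∃ k₀ : ℕ, 1 ≤ k₀ ∧ ∀ k, k₀ ≤ k → c * (k : ℝ) ^ (-p) ≤ ε := by
  have h : Filter.Tendsto (fun k : ℕ => c * (k : ℝ) ^ (-p)) Filter.atTop (nhds (c * 0)) :=
    ((tendsto_rpow_neg_atTop hp).comp tendsto_natCast_atTop_atTop).const_mul c
  rw [mul_zero] at h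
  obtain ⟨k₀, hk₀⟩ := Filter.eventually_atTop.1 (h.eventually (ge_mem_nhds hε))
  exact ⟨max k₀ 1, le_max_right _ _, fun k hk => hk₀ k ((le_max_left _ _).trans hk)⟩

/-- The comparison sequence `K' k^{-q}` loses at most `q K' k^{-1} k^{-q} ≤ q K' k^{-p} k^{-q}` in
one step, while the contraction removes `c K' k^{-p} k^{-q}`. The surplus `(c - q) K'` pays for `K`.
-/
theorem rate_of_recursion {u : ℕ → ℝ} {p q c K : ℝ} {k₀ : ℕ} (hp : 0 < p) (hp1 : p ≤ 1)
    (hq : 0 < q) (hqc : q < c)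
    (h : ∀ k, k₀ ≤ k → u (k + 1) ≤ (1 - c * (k : ℝ) ^ (-p)) * u k
      + K * ((k : ℝ) ^ (-p) * (k : ℝ) ^ (-q))) :
    ∃ K', ∀ k : ℕ, 1 ≤ k → u k ≤ K' * (k : ℝ) ^ (-q) := by
  obtain ⟨k₁, hk₁, hsmall⟩ := eventually_mul_rpow_neg_le c hp one_pos
  set m := max k₀ k₁ with hm
  -- The second bound starts the induction at `m`; the third closes its step.
  obtain ⟨K', hK0, hKm, hKc⟩ : ∃ K' : ℝ, 0 ≤ K' ∧ u m * (m : ℝ) ^ q ≤ K' ∧ K / (c - q) ≤ K' :=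
    ⟨max 0 (max (u m * (m : ℝ) ^ q) (K / (c - q))), le_max_left _ _,
      (le_max_left _ _).trans (le_max_right _ _), (le_max_right _ _).trans (le_max_right _ _)⟩
  refine exists_rate_of_eventually (k₀ := m) (K := K') fun k hk => ?_
  induction k, hk using Nat.le_induction with
  | base =>
    have hmp : (0 : ℝ) < m := by exact_mod_cast hk₁.trans (le_max_right _ _)
    calc u m = u m * (m : ℝ) ^ q * (m : ℝ) ^ (-q) := by
          rw [mul_assoc, ← Real.rpow_add hmp]; simp
      _ ≤ _ := by gcongr
  | succ k hk ih =>
    have hk1 : 1 ≤ k := hk₁.trans ((le_max_right _ _).trans hk)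
    have hkp : (0 : ℝ) < k := by exact_mod_cast hk1
    have h1 := h k ((le_max_left _ _).trans hk)
    have h2 := hsmall k ((le_max_right _ _).trans hk)
    have h3 := rpow_neg_sub_succ_le hq hkp
    have h4 : (k : ℝ)⁻¹ ≤ (k : ℝ) ^ (-p) := by
      rw [← Real.rpow_neg_one]
      exact Real.rpow_le_rpow_of_exponent_le (by exact_mod_cast hk1) (by linarith)
    have h5 : 0 < (k : ℝ) ^ (-q) := Real.rpow_pos_of_pos hkp _
    have h6 : 0 < (k : ℝ) ^ (-p) := Real.rpow_pos_of_pos hkp _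
    have h7 : K ≤ K' * (c - q) := by
      rwa [← div_le_iff₀ (by linarith)]
    push_cast
    have h8 := mul_le_mul_of_nonneg_left ih (sub_nonneg.2 h2)
    have h9 : (k : ℝ) ^ (-q) - (k + 1 : ℝ) ^ (-q) ≤ q * ((k : ℝ) ^ (-p) * (k : ℝ) ^ (-q)) := by
      refine h3.trans ?_
      rw [mul_assoc]
      gcongr
    have h10 := mul_le_mul_of_nonneg_left h9 hK0
    have h11 := mul_le_mul_of_nonneg_right h7 (mul_pos h6 h5).le
    nlinarith

theorem bounded_of_recursion {u β : ℕ → ℝ} {c K : ℝ} {k₀ : ℕ} (hc : 0 < c)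
    (hβ : ∀ k, k₀ ≤ k → 0 ≤ β k ∧ c * β k ≤ 1)
    (h : ∀ k, k₀ ≤ k → u (k + 1) ≤ (1 - c * β k) * u k + K * β k) :
    ∃ K', ∀ k, u k ≤ K' := by
  -- Any level above the equilibrium `K / c` is preserved by the recursion.
  have key : ∀ k, k₀ ≤ k → u k ≤ max (u k₀) (K / c) := by
    intro k hk
    induction k, hk using Nat.le_induction with
    | base => exact le_max_left _ _
    | succ k hk ih =>
      have h1 := h k hk
      obtain ⟨h2, h3⟩ := hβ k hk
      have h4 : K ≤ max (u k₀) (K / c) * c := by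
        rw [← div_le_iff₀ hc]; exact le_max_right _ _
      generalize max (u k₀) (K / c) = M at *
      nlinarith [mul_le_mul_of_nonneg_left ih (sub_nonneg.2 h3), mul_le_mul_of_nonneg_right h4 h2]
  refine ⟨max (u k₀) (K / c) + ∑ i ∈ Finset.range k₀, |u i - max (u k₀) (K / c)|, fun k => ?_⟩
  rcases le_or_gt k₀ k with hk | hk
  · exact (key k hk).trans (le_add_of_nonneg_right (Finset.sum_nonneg fun _ _ => abs_nonneg _))
  · have := Finset.single_le_sum (f := fun i => |u i - max (u k₀) (K / c)|)
      (fun i _ => abs_nonneg _) (Finset.mem_range.2 hk)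
    have h2 := le_abs_self (u k - max (u k₀) (K / c))
    linarith

end Recursions

/-! ### Calculus of bounds on expectations -/

section MeanBounds

/-- `g` is integrable with expectation at most `c`. -/
def HasMeanLE {Ω : Type*} [MeasurableSpace Ω] (μ : Measure Ω) (g : Ω → ℝ) (c : ℝ) : Prop :=
  Integrable g μ ∧ ∫ o, g o ∂μ ≤ c

variable {Ω : Type*} [MeasurableSpace Ω] {μ : Measure Ω} {f g : Ω → ℝ} {b c : ℝ}

theorem HasMeanLE.trans (h : HasMeanLE μ g b) (hbc : b ≤ c) : HasMeanLE μ g c :=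
  ⟨h.1, h.2.trans hbc⟩

theorem HasMeanLE.of_le (h : HasMeanLE μ g c) (hf : AEStronglyMeasurable f μ)
    (h0 : ∀ᵐ o ∂μ, 0 ≤ f o) (hfg : ∀ᵐ o ∂μ, f o ≤ g o) : HasMeanLE μ f c := by
  have hint : Integrable f μ := by
    refine h.1.mono' hf ?_
    filter_upwards [h0, hfg] with o h1 h2
    rwa [Real.norm_of_nonneg h1]
  exact ⟨hint, (integral_mono_ae hint h.1 hfg).trans h.2⟩

theorem HasMeanLE.add (hf : HasMeanLE μ f b) (hg : HasMeanLE μ g c) :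
    HasMeanLE μ (fun o => f o + g o) (b + c) :=
  ⟨hf.1.add hg.1, by rw [integral_add hf.1 hg.1]; exact add_le_add hf.2 hg.2⟩

theorem HasMeanLE.const_mul (hf : HasMeanLE μ f b) {t : ℝ} (ht : 0 ≤ t) :
    HasMeanLE μ (fun o => t * f o) (t * b) :=
  ⟨hf.1.const_mul t, by rw [integral_const_mul]; exact mul_le_mul_of_nonneg_left hf.2 ht⟩

theorem hasMeanLE_const [IsProbabilityMeasure μ] (c : ℝ) : HasMeanLE μ (fun _ => c) c :=
  ⟨integrable_const c, by simp⟩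

/-- Lower integrals deliver integrability together with the bound, so the tower property and Fubini
can be applied to products and compositions not yet known to be integrable. -/
theorem hasMeanLE_of_lintegral (hf : AEStronglyMeasurable f μ) (h0 : ∀ o, 0 ≤ f o) (hc : 0 ≤ c)
    (h : ∫⁻ o, ENNReal.ofReal (f o) ∂μ ≤ ENNReal.ofReal c) : HasMeanLE μ f c := by
  have hint : Integrable f μ := by
    refine ⟨hf, ?_⟩
    rw [hasFiniteIntegral_iff_ofReal (Filter.Eventually.of_forall h0)]
    exact h.trans_lt ENNReal.ofReal_lt_top
  refine ⟨hint, ?_⟩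
  rw [← ofReal_integral_eq_lintegral_ofReal hint (Filter.Eventually.of_forall h0)] at h
  exact (ENNReal.ofReal_le_ofReal_iff hc).1 h

theorem HasMeanLE.lintegral_le (h : HasMeanLE μ f c) (h0 : ∀ o, 0 ≤ f o) :
    ∫⁻ o, ENNReal.ofReal (f o) ∂μ ≤ ENNReal.ofReal c := by
  rw [← ofReal_integral_eq_lintegral_ofReal h.1 (Filter.Eventually.of_forall h0)]
  exact ENNReal.ofReal_le_ofReal h.2

theorem HasMeanLE.nonneg (h : HasMeanLE μ f c) (h0 : ∀ o, 0 ≤ f o) : 0 ≤ c :=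
  (integral_nonneg h0).trans h.2

/-- Jensen's inequality for the square. -/
theorem HasMeanLE.of_sq [IsProbabilityMeasure μ] (hf : AEStronglyMeasurable f μ)
    (h0 : ∀ o, 0 ≤ f o) (h : HasMeanLE μ (fun o => f o ^ 2) c) : HasMeanLE μ f (√c) := by
  have hint : Integrable f μ := by
    refine ((integrable_const (1 : ℝ)).add h.1).mono' hf (Filter.Eventually.of_forall fun o => ?_)
    rw [Real.norm_of_nonneg (h0 o)]
    simp only [Pi.add_apply]
    nlinarith [sq_nonneg (f o - 1), h0 o]
  refine ⟨hint, Real.le_sqrt_of_sq_le (le_trans ?_ h.2)⟩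
  set m := ∫ o, f o ∂μ
  -- The tangent to the parabola at the mean `m` lies below it.
  have h1 : ∫ o, (2 * m * f o - m ^ 2) ∂μ ≤ ∫ o, f o ^ 2 ∂μ := by
    refine integral_mono ((hint.const_mul _).sub (integrable_const _)) h.1 fun o => ?_
    simp only
    nlinarith [sq_nonneg (f o - m)]
  rw [integral_sub (hint.const_mul _) (integrable_const _), integral_const_mul] at h1
  simp only [integral_const, probReal_univ, smul_eq_mul, one_mul] at h1
  change 2 * m * m - m ^ 2 ≤ _ at h1
  linarith

end MeanBounds

/-! ### Moments of one perturbed step from a deterministic point -/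

section OneStep

variable {Ω : Type*} [MeasurableSpace Ω] {μ : Measure Ω} [IsProbabilityMeasure μ]
  {H : Type*} [NormedAddCommGroup H] [InnerProductSpace ℝ H] [CompleteSpace H]

theorem hasMeanLE_norm_sub_smul_sq {g : Ω → H} (hg : Integrable g μ) {M : ℝ}
    (h2 : HasMeanLE μ (fun o => ‖g o‖ ^ 2) M) (e : H) (α : ℝ) :
    HasMeanLE μ (fun o => ‖e - α • g o‖ ^ 2)
      (‖e‖ ^ 2 - 2 * α * ⟪e, ∫ o, g o ∂μ⟫ + α ^ 2 * M) := by
  have h : (fun o => ‖e - α • g o‖ ^ 2)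
      = fun o => ‖e‖ ^ 2 - 2 * α * ⟪e, g o⟫ + α ^ 2 * ‖g o‖ ^ 2 := by
    ext o
    rw [norm_sub_sq_real, inner_smul_right, norm_smul, mul_pow, Real.norm_eq_abs, sq_abs]
    ring
  have hi : Integrable (fun o => ‖e‖ ^ 2 - 2 * α * ⟪e, g o⟫) μ :=
    (integrable_const _).sub ((hg.const_inner e).const_mul _)
  rw [h]
  refine HasMeanLE.add ⟨hi, le_of_eq ?_⟩ (h2.const_mul (sq_nonneg α))
  rw [integral_sub (integrable_const _) ((hg.const_inner e).const_mul _), integral_const_mul,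
    integral_inner hg]
  simp

theorem hasMeanLE_norm_add_smul_sq {ξ : Ω → H} (hξ : Integrable ξ μ) (h0 : ∫ o, ξ o ∂μ = 0)
    {M : ℝ} (h2 : HasMeanLE μ (fun o => ‖ξ o‖ ^ 2) M) (A : H) (β : ℝ) :
    HasMeanLE μ (fun o => ‖A + β • ξ o‖ ^ 2) (‖A‖ ^ 2 + β ^ 2 * M) := by
  have h := hasMeanLE_norm_sub_smul_sq hξ h2 A (-β)
  simpa [h0] using h

/-- Centering removes the only term of first order in `β`; the remaining ones carry `β²` or `β⁴` and
can be absorbed by a contraction of order `β`. -/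
theorem hasMeanLE_norm_add_smul_four {ξ : Ω → H} (hξ : Integrable ξ μ) (h0 : ∫ o, ξ o ∂μ = 0)
    {M M' : ℝ} (h2 : HasMeanLE μ (fun o => ‖ξ o‖ ^ 2) M)
    (h4 : HasMeanLE μ (fun o => ‖ξ o‖ ^ 4) M') (A : H) (β : ℝ) :
    HasMeanLE μ (fun o => ‖A + β • ξ o‖ ^ 4)
      (‖A‖ ^ 4 + 8 * ‖A‖ ^ 2 * (β ^ 2 * M) + 3 * (β ^ 4 * M')) := by
  have hi : Integrable (fun o => 4 * ‖A‖ ^ 2 * β * ⟪A, ξ o⟫) μ :=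
    (hξ.const_inner A).const_mul _
  have e1 : HasMeanLE μ (fun o => 4 * ‖A‖ ^ 2 * β * ⟪A, ξ o⟫) 0 := by
    refine ⟨hi, ?_⟩
    rw [integral_const_mul, integral_inner hξ, h0]
    simp
  have e2 := (((hasMeanLE_const (μ := μ) (‖A‖ ^ 4)).add e1).add
    (h2.const_mul (by positivity : 0 ≤ 8 * ‖A‖ ^ 2 * β ^ 2))).add
    (h4.const_mul (by positivity : 0 ≤ 3 * β ^ 4))
  refine (e2.of_le ?_ (Filter.Eventually.of_forall fun o => by positivity)
    (Filter.Eventually.of_forall fun o => ?_)).trans (le_of_eq (by ring))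
  · exact ((aestronglyMeasurable_const.add (hξ.1.const_smul β)).norm.pow 4)
  · have h := norm_add_pow_four_le_inner A (β • ξ o)
    rw [inner_smul_right, norm_smul, mul_pow, mul_pow, Real.norm_eq_abs, sq_abs,
      show |β| ^ 4 = β ^ 4 by rw [← abs_pow, abs_of_nonneg (by positivity)]] at h
    linarith

end OneStep

/-! ### Measurability of the directions and the tower property along the levels -/

section Oracle

variable {d : ℕ → ℕ} {W : ℕ → Type*} [∀ j, MeasurableSpace (W j)]

theorem measurable_eval_level (j : ℕ) : Measurable fun w : SamplePath W => w j :=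
  measurable_pi_apply j

theorem measurable_eval_lowerLevels {i j : ℕ} (h : i < j) :
    Measurable[lowerLevels W j] fun w : SamplePath W => w i := by
  rw [measurable_iff_comap_le]
  exact le_iSup₂_of_le i h le_rfl

theorem lowerLevels_mono {i j : ℕ} (h : i ≤ j) : lowerLevels W i ≤ lowerLevels W j :=
  iSup₂_le fun k hk => le_iSup₂_of_le k (hk.trans_le h) le_rfl

theorem measurable_clm_apply {V V' : Type*} [NormedAddCommGroup V] [NormedSpace ℝ V]
    [NormedAddCommGroup V'] [NormedSpace ℝ V'] [FiniteDimensional ℝ V] [FiniteDimensional ℝ V']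
    [MeasurableSpace V] [BorelSpace V] [MeasurableSpace V'] [BorelSpace V']
    {S : Type*} {m : MeasurableSpace S} {A : S → V →L[ℝ] V'} {v : S → V}
    (hA : Measurable A) (hv : Measurable v) : Measurable fun s => A s (v s) := by
  have := FiniteDimensional.proper ℝ V
  have := FiniteDimensional.proper ℝ (V →L[ℝ] V')
  have hc : Continuous fun p : (V →L[ℝ] V') × V => p.1 p.2 :=
    isBoundedBilinearMap_apply.continuous
  exact hc.measurable.comp (hA.prodMk hv)

variable (O : Oracle d W)

theorem measurable_quasiGrad_joint (j : ℕ) :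
    Measurable fun p : SamplePath W × (∀ i, E d i) => quasiGrad O p.1 p.2 j := by
  induction j with
  | zero => exact measurable_const
  | succ j ih =>
    exact measurable_clm_apply ((O.measurable_grad j).comp
      (((measurable_eval_level j).comp measurable_fst).prodMk
        ((measurable_pi_apply (j + 1)).comp measurable_snd))) ih

theorem measurable_quasiGrad (y : ∀ j, E d j) (j : ℕ) :
    Measurable[lowerLevels W j] fun w : SamplePath W => quasiGrad O w y j := by
  induction j with
  | zero => exact measurable_const
  | succ j ih =>
    exact measurable_clm_apply ((O.measurable_grad j).comp
      ((measurable_eval_lowerLevels j.lt_succ_self).prodMk measurable_const))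
      (ih.mono (lowerLevels_mono j.le_succ) le_rfl)

theorem measurable_gradSample (j : ℕ) (x : E d j) :
    Measurable[lowerLevels W j] fun w : SamplePath W => gradSample O w j x := by
  induction j with
  | zero => exact measurable_const
  | succ j ih =>
    exact measurable_clm_apply ((O.measurable_grad j).comp
      ((measurable_eval_lowerLevels j.lt_succ_self).prodMk measurable_const))
      ((ih _).mono (lowerLevels_mono j.le_succ) le_rfl)

theorem measurable_grad_eval (j : ℕ) (x : E d (j + 1)) :
    Measurable fun w : SamplePath W => O.grad j (w j) x :=
  (O.measurable_grad j).comp ((measurable_eval_level j).prodMk measurable_const)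

variable {O} {P : Measure (SamplePath W)} [IsProbabilityMeasure P]

theorem CondBound.hasMeanLE {j : ℕ} {g : SamplePath W → ℝ} {c : ℝ} (h : CondBound P j g c) :
    HasMeanLE P g c := by
  refine ⟨h.1, ?_⟩
  rw [← integral_condExp (lowerLevels_le j)]
  refine (integral_mono_ae integrable_condExp (integrable_const c) h.2).trans ?_
  simp

/-- The tower property for a product with a factor that depends on the lower levels only. -/
theorem CondBound.mul {j : ℕ} {g Z : SamplePath W → ℝ} {c M : ℝ} (h : CondBound P j g c)
    (hg : Measurable g) (hg0 : ∀ w, 0 ≤ g w) (hc : 0 ≤ c) (hZ : Measurable[lowerLevels W j] Z)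
    (hZ0 : ∀ w, 0 ≤ Z w) (hM : HasMeanLE P Z M) : HasMeanLE P (fun w => g w * Z w) (c * M) := by
  have hle := lowerLevels_le (W := W) j
  have hZ' : Measurable[lowerLevels W j] fun w => ENNReal.ofReal (Z w) :=
    ENNReal.measurable_ofReal.comp hZ
  refine hasMeanLE_of_lintegral (hg.mul (hZ.mono hle le_rfl)).aestronglyMeasurable
    (fun w => mul_nonneg (hg0 w) (hZ0 w)) (mul_nonneg hc (hM.nonneg hZ0)) ?_
  have hg' : Measurable fun w => ENNReal.ofReal (g w) := ENNReal.measurable_ofReal.comp hg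
  set ν := P.withDensity fun w => ENNReal.ofReal (g w) with hν
  -- On events of the lower levels, the bound on the conditional expectation says that the measure
  -- with density `g` is at most `c • P`. Integrating `Z` against both sides is then enough, without
  -- knowing that `g * Z` is integrable.
  have hν_le : ν.trim hle ≤ ENNReal.ofReal c • P.trim hle := by
    refine Measure.le_iff.2 fun s hs => ?_
    rw [trim_measurableSet_eq hle hs, Measure.smul_apply, trim_measurableSet_eq hle hs, hν,
      withDensity_apply _ (hle s hs), ← ofReal_integral_eq_lintegral_ofReal h.1.integrableOn
        (Filter.Eventually.of_forall hg0), ← setIntegral_condExp hle h.1 hs, smul_eq_mul]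
    have h1 : ∫ w in s, (P[g | lowerLevels W j]) w ∂P ≤ ∫ _ in s, c ∂P :=
      integral_mono_ae integrable_condExp.integrableOn (integrable_const c).integrableOn
        (ae_restrict_of_ae h.2)
    rw [setIntegral_const, smul_eq_mul, mul_comm] at h1
    refine (ENNReal.ofReal_le_ofReal h1).trans ?_
    rw [ENNReal.ofReal_mul hc, ofReal_measureReal]
  calc ∫⁻ w, ENNReal.ofReal (g w * Z w) ∂P
      = ∫⁻ w, ENNReal.ofReal (Z w) ∂ν := by
        rw [hν, lintegral_withDensity_eq_lintegral_mul _ hg' (hZ'.mono hle le_rfl)]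
        simp only [Pi.mul_apply, ENNReal.ofReal_mul (hg0 _)]
    _ = ∫⁻ w, ENNReal.ofReal (Z w) ∂(ν.trim hle) := (lintegral_trim hle hZ').symm
    _ ≤ ∫⁻ w, ENNReal.ofReal (Z w) ∂(ENNReal.ofReal c • P.trim hle) :=
        lintegral_mono' hν_le le_rfl
    _ = ENNReal.ofReal c * ∫⁻ w, ENNReal.ofReal (Z w) ∂P := by
        rw [lintegral_smul_measure, lintegral_trim hle hZ', smul_eq_mul]
    _ ≤ ENNReal.ofReal (c * M) := by
        rw [ENNReal.ofReal_mul hc]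
        gcongr
        exact hM.lintegral_le hZ0

/-- The partial product up to level `j` depends on the lower levels only, so the next operator norm
can be averaged conditionally on it; each level contributes one factor. No independence of the
levels is needed. -/
theorem hasMeanLE_quasiGrad {p n : ℕ} {c : ℕ → ℝ} (y : ∀ j, E d j)
    (h : ∀ i < n, 0 ≤ c i ∧ CondBound P i (fun w => ‖O.grad i (w i) (y (i + 1))‖ ^ p) (c i)) :
    ∀ j ≤ n, HasMeanLE P (fun w => ‖quasiGrad O w y j‖ ^ p) (∏ i ∈ Finset.range j, c i) := by
  intro j
  induction j with
  | zero =>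
    intro _
    have : ‖unitVec d‖ = 1 := by
      simp only [unitVec]
      exact (PiLp.norm_single _ _ _ _).trans norm_one
    simpa [quasiGrad, this] using hasMeanLE_const (μ := P) 1
  | succ j ih =>
    intro hj
    obtain ⟨hc, hb⟩ := h j (by omega)
    have hq := measurable_quasiGrad O y j
    have := hb.mul (Z := fun w => ‖quasiGrad O w y j‖ ^ p) ((measurable_grad_eval O j _).norm.pow_const p) (fun w => by positivity) hc
      ((continuous_norm.pow p).measurable.comp hq) (fun w => by positivity) (ih (by omega))
    rw [Finset.prod_range_succ, mul_comm]
    refine this.of_le ?_ (Filter.Eventually.of_forall fun w => by positivity)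
      (Filter.Eventually.of_forall fun w => ?_)
    · exact (((measurable_quasiGrad O y (j + 1)).mono (lowerLevels_le _) le_rfl).norm.pow_const
        p).aestronglyMeasurable
    · rw [← mul_pow]
      exact pow_le_pow_left₀ (norm_nonneg _) ((O.grad j (w j) (y (j + 1))).le_opNorm _) p

end Oracle

/-! ### Consequences of the assumptions: Lipschitz levels, bias of the direction, one main step -/

section Oracle

variable {d : ℕ → ℕ} {W : ℕ → Type*} [∀ j, MeasurableSpace (W j)] {O : Oracle d W} {N : ℕ}
  {X : Set (E d (N + 1))} {P : Measure (SamplePath W)} [IsProbabilityMeasure P] {C V L : ℕ → ℝ}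

theorem BasicAssumption.integral_value (h : BasicAssumption O N X P C V L) {j : ℕ} (hj : j ≤ N)
    (x : E d (j + 1)) : ∫ w, O.value j (w j) x ∂P = O.f j x := by
  rw [← integral_condExp (lowerLevels_le j), integral_congr_ae (h.value_unbiased j hj x)]
  simp

theorem BasicAssumption.integrable_noise (h : BasicAssumption O N X P C V L) {j : ℕ}
    (hj : j ≤ N) (x : E d (j + 1)) : Integrable (fun w => O.value j (w j) x - O.f j x) P :=
  (h.value_integrable j hj x).sub (integrable_const _)

theorem BasicAssumption.integral_noise (h : BasicAssumption O N X P C V L) {j : ℕ}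
    (hj : j ≤ N) (x : E d (j + 1)) : ∫ w, (O.value j (w j) x - O.f j x) ∂P = 0 := by
  rw [integral_sub (h.value_integrable j hj x) (integrable_const _), h.integral_value hj]
  simp

/-- For an outer level, `f` is the mean of the samples. Near `z` each sample is Lipschitz with
constant `‖grad z‖ + L ‖x - z‖`, and `‖grad z‖ ≤ 1 + ‖grad z‖²` has mean at most `1 + C`.
Restricting to `L ‖x - z‖ ≤ 1` bounds the derivative of `f` by `2 + C` at every point, and the mean
value inequality makes this global. Differentiation under the integral is avoided. -/
theorem BasicAssumption.exists_lipschitz (h : BasicAssumption O N X P C V L) {j : ℕ}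
    (hj : j ≤ N) : ∃ K, 0 ≤ K ∧ ∀ x z, ‖O.f j x - O.f j z‖ ≤ K * ‖x - z‖ := by
  rcases hj.lt_or_eq with hj' | rfl
  swap
  · exact ⟨C j, (h.pos j le_rfl).1.le, h.inner_lipschitz⟩
  have hC := (h.pos j hj).1
  have hL := (h.pos j hj).2.2
  have hlocal : ∀ x z, ‖O.f j x - O.f j z‖ ≤ (1 + C j + L j * ‖x - z‖) * ‖x - z‖ := by
    intro x z
    rw [← h.integral_value hj x, ← h.integral_value hj z,
      ← integral_sub (h.value_integrable j hj x) (h.value_integrable j hj z)]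
    have h1 := (((hasMeanLE_const (μ := P) 1).add (h.outer_grad_bound j hj' z).hasMeanLE).add
      (hasMeanLE_const (L j * ‖x - z‖))).const_mul (norm_nonneg (x - z))
    refine (norm_integral_le_of_norm_le h1.1 ?_).trans (h1.2.trans (le_of_eq (by ring)))
    filter_upwards [h.outer_grad j hj', h.outer_sample_smooth j hj'] with w hw hs
    rw [mul_comm]
    refine (convex_closedBall z ‖x - z‖).norm_image_sub_le_of_norm_hasFDerivWithin_le
      (fun t _ => (hw t).hasFDerivWithinAt) (fun t ht => ?_)
      (Metric.mem_closedBall_self (norm_nonneg _)) (by simp [dist_eq_norm])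
    rw [LinearIsometryEquiv.norm_map]
    have h2 := norm_add_le (O.grad j (w j) t - O.grad j (w j) z) (O.grad j (w j) z)
    rw [sub_add_cancel] at h2
    have h3 : L j * ‖t - z‖ ≤ L j * ‖x - z‖ := by
      gcongr
      simpa [dist_eq_norm] using ht
    nlinarith [hs t z, sq_nonneg (‖O.grad j (w j) z‖ - 1), norm_nonneg (O.grad j (w j) z)]
  have hd : Differentiable ℝ (O.f j) := (h.outer_contDiff j hj').differentiable one_ne_zero
  have hbound : ∀ z, ‖fderiv ℝ (O.f j) z‖ ≤ 2 + C j := by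
    intro z
    refine (hd z).hasFDerivAt.le_of_lip' (by linarith) ?_
    filter_upwards [Metric.closedBall_mem_nhds z (inv_pos.2 hL)] with x hx
    refine (hlocal x z).trans (mul_le_mul_of_nonneg_right ?_ (norm_nonneg _))
    have : L j * ‖x - z‖ ≤ L j * (L j)⁻¹ := by
      gcongr
      simpa [dist_eq_norm] using hx
    rw [mul_inv_cancel₀ hL.ne'] at this
    linarith
  exact ⟨2 + C j, by linarith, fun x z => convex_univ.norm_image_sub_le_of_norm_fderiv_le
    (fun t _ => hd t) (fun t _ => hbound t) (Set.mem_univ z) (Set.mem_univ x)⟩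

omit [IsProbabilityMeasure P] in
theorem BasicAssumption.continuous_f (h : BasicAssumption O N X P C V L) {j : ℕ}
    (hj : j ≤ N) : Continuous (O.f j) := by
  rcases hj.lt_or_eq with hj' | rfl
  · exact (h.outer_contDiff j hj').continuous
  · exact h.inner_continuous

omit [IsProbabilityMeasure P] in
theorem BasicAssumption.continuous_objective (h : BasicAssumption O N X P C V L) :
    Continuous (objective O (N + 1)) := by
  have key : ∀ j ≤ N + 1, Continuous (comp O j) := by
    intro j
    induction j with
    | zero => exact fun _ => continuous_id
    | succ j ih => exact fun hj => (ih (by omega)).comp (h.continuous_f (by omega))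
  exact (EuclideanSpace.proj (𝕜 := ℝ) (0 : Fin 1)).continuous.comp (key _ le_rfl)

theorem norm_sub_sub_le_of_fderiv_lipschitz {H H' : Type*} [NormedAddCommGroup H]
    [NormedSpace ℝ H] [NormedAddCommGroup H'] [NormedSpace ℝ H'] {f : H → H'} {K : ℝ}
    (hf : Differentiable ℝ f) (hK : 0 ≤ K)
    (hl : ∀ x z, ‖fderiv ℝ f x - fderiv ℝ f z‖ ≤ K * ‖x - z‖) (x z : H) :
    ‖f x - f z - fderiv ℝ f z (x - z)‖ ≤ K * ‖x - z‖ ^ 2 := by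
  rw [sq, ← mul_assoc]
  refine (convex_closedBall z ‖x - z‖).norm_image_sub_le_of_norm_fderiv_le' (fun t _ => hf t)
    (fun t ht => (hl t z).trans ?_) (Metric.mem_closedBall_self (norm_nonneg _))
    (by simp [dist_eq_norm])
  gcongr
  simpa [dist_eq_norm] using ht

/-- The splitting `(A - B) u + B (u - v)` suits the tower property: `A - B` has an almost sure
bound, and the random `B` multiplies a difference that depends on the lower levels only. -/
theorem norm_clm_apply_sub_sq_le {H H' : Type*} [NormedAddCommGroup H] [NormedSpace ℝ H]
    [NormedAddCommGroup H'] [NormedSpace ℝ H'] (A B : H →L[ℝ] H') (u v : H) {K : ℝ}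
    (hAB : ‖A - B‖ ≤ K) :
    ‖A u - B v‖ ^ 2 ≤ 2 * K ^ 2 * ‖u‖ ^ 2 + 2 * (‖B‖ ^ 2 * ‖u - v‖ ^ 2) := by
  have h1 : A u - B v = (A - B) u + B (u - v) := by simp
  have h2 : ‖A u - B v‖ ≤ K * ‖u‖ + ‖B‖ * ‖u - v‖ := by
    rw [h1]
    exact (norm_add_le _ _).trans (add_le_add ((A - B).le_of_opNorm_le hAB u) (B.le_opNorm _))
  have h3 := pow_le_pow_left₀ (norm_nonneg _) h2 2
  nlinarith [sq_nonneg (K * ‖u‖ - ‖B‖ * ‖u - v‖)]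

theorem measurable_quasiGrad_sub (y : ∀ j, E d j) (j : ℕ) (x : E d j) :
    Measurable[lowerLevels W j] fun w => quasiGrad O w y j - gradSample O w j x :=
  (measurable_quasiGrad O y j).sub (measurable_gradSample O j x)

theorem BasicAssumption.hasMeanLE_bias_succ (h : BasicAssumption O N X P C V L) {j : ℕ}
    (hj : j < N) (y : ∀ j, E d j) (x : E d (j + 1)) {D : ℝ}
    (hD : HasMeanLE P (fun w => ‖quasiGrad O w y j - gradSample O w j (O.f j x)‖ ^ 2) D) :
    HasMeanLE P (fun w => ‖quasiGrad O w y (j + 1) - gradSample O w (j + 1) x‖ ^ 2)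
      (2 * (L j * ‖y (j + 1) - x‖) ^ 2 * ∏ i ∈ Finset.range j, C i + 2 * (C j * D)) := by
  have hq : HasMeanLE P (fun w => ‖quasiGrad O w y j‖ ^ 2) (∏ i ∈ Finset.range j, C i) :=
    hasMeanLE_quasiGrad (n := j) y (fun i hi => ⟨(h.pos i (by omega)).1.le,
      h.outer_grad_bound i (by omega) _⟩) j le_rfl
  have h1 := (h.outer_grad_bound j hj x).mul
    (Z := fun w => ‖quasiGrad O w y j - gradSample O w j (O.f j x)‖ ^ 2)
    ((measurable_grad_eval O j x).norm.pow_const 2) (fun w => by positivity)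
    (h.pos j hj.le).1.le
    ((continuous_norm.pow 2).measurable.comp (measurable_quasiGrad_sub y j _))
    (fun w => by positivity) hD
  refine HasMeanLE.of_le ((hq.const_mul (by positivity)).add (h1.const_mul zero_le_two)) ?_
    (Filter.Eventually.of_forall fun w => by positivity) ?_
  · exact ((continuous_norm.pow 2).measurable.comp
      ((measurable_quasiGrad_sub y (j + 1) x).mono (lowerLevels_le _) le_rfl)).aestronglyMeasurable
  · filter_upwards [h.outer_sample_smooth j hj] with w hw
    exact norm_clm_apply_sub_sq_le _ _ _ _ (hw (y (j + 1)) x)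

/-- Moving one level inward replaces the reference point `x` by `f j x`. The distance from `y j` to
it is at most the tracking error of level `j` plus `K ‖y (j + 1) - x‖`, so all errors accumulate in
one sum. -/
theorem BasicAssumption.exists_bias_outer (h : BasicAssumption O N X P C V L) {j : ℕ}
    (hj1 : 1 ≤ j) : j ≤ N → ∃ B, 0 ≤ B ∧ ∀ (y : ∀ j, E d j) (x : E d j),
      HasMeanLE P (fun w => ‖quasiGrad O w y j - gradSample O w j x‖ ^ 2)
        (B * (‖y j - x‖ ^ 2 + ∑ i ∈ Finset.Ico 1 j, ‖y i - O.f i (y (i + 1))‖ ^ 2)) := by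
  have hprod : ∀ j ≤ N, 0 ≤ ∏ i ∈ Finset.range j, C i := fun j hj =>
    Finset.prod_nonneg fun i hi => (h.pos i (by have := Finset.mem_range.1 hi; omega)).1.le
  induction j, hj1 using Nat.le_induction with
  | base =>
    intro hj
    refine ⟨2 * L 0 ^ 2 * ∏ i ∈ Finset.range 0, C i, by
      have := hprod 0 (by omega); positivity, fun y x => ?_⟩
    refine (h.hasMeanLE_bias_succ (j := 0) (by omega) y x (D := 0) ?_).trans (le_of_eq ?_)
    · simpa [quasiGrad, gradSample] using hasMeanLE_const (μ := P) 0
    · simp only [Finset.Ico_self, Finset.sum_empty]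
      ring
  | succ j hj1 ih =>
    intro hj
    obtain ⟨B, hB, hb⟩ := ih (by omega)
    obtain ⟨K, hK, hlip⟩ := h.exists_lipschitz (show j ≤ N by omega)
    have hC := (h.pos j (by omega)).1.le
    have hP := hprod j (by omega)
    set M := ∏ i ∈ Finset.range j, C i with hM
    refine ⟨2 * L j ^ 2 * M + 4 * C j * B * (1 + K ^ 2), by positivity, fun y x => ?_⟩
    refine (h.hasMeanLE_bias_succ (by omega) y x (hb y (O.f j x))).trans ?_
    rw [Finset.sum_Ico_succ_top hj1, ← hM]
    have h0 : 0 ≤ ∑ i ∈ Finset.Ico 1 j, ‖y i - O.f i (y (i + 1))‖ ^ 2 :=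
      Finset.sum_nonneg fun i _ => by positivity
    set S := ∑ i ∈ Finset.Ico 1 j, ‖y i - O.f i (y (i + 1))‖ ^ 2
    set t := ‖y (j + 1) - x‖
    set r := ‖y j - O.f j (y (j + 1))‖
    have h1 : ‖y j - O.f j x‖ ≤ r + K * t := by
      have := norm_add_le (y j - O.f j (y (j + 1))) (O.f j (y (j + 1)) - O.f j x)
      rw [sub_add_sub_cancel] at this
      exact this.trans (add_le_add_right (hlip _ _) _)
    have h2 : ‖y j - O.f j x‖ ^ 2 ≤ 2 * r ^ 2 + 2 * K ^ 2 * t ^ 2 := by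
      have := pow_le_pow_left₀ (norm_nonneg _) h1 2
      nlinarith [sq_nonneg (r - K * t)]
    have h3 := mul_le_mul_of_nonneg_left h2 (mul_nonneg hC hB)
    have e1 : 0 ≤ L j ^ 2 * M * (S + r ^ 2) := by positivity
    have e2 : 0 ≤ C j * B * S := by positivity
    have e4 : 0 ≤ C j * B * t ^ 2 := by positivity
    have e3 : 0 ≤ C j * B * K ^ 2 * (S + r ^ 2) := by positivity
    linarith

/-- At the innermost level both directions apply the same noisy gradient at the same point, so only
the difference of the outer factors remains and no smoothness of the innermost samples enters. -/
theorem BasicAssumption.exists_bias (h : BasicAssumption O N X P C V L) :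
    ∃ B, 0 ≤ B ∧ ∀ y : ∀ j, E d j, y (N + 1) ∈ X →
      HasMeanLE P (fun w => ‖quasiGrad O w y (N + 1) - gradSample O w (N + 1) (y (N + 1))‖ ^ 2)
        (B * ∑ i ∈ Finset.Icc 1 N, ‖y i - O.f i (y (i + 1))‖ ^ 2) := by
  obtain ⟨B, hB, hb⟩ : ∃ B, 0 ≤ B ∧ ∀ y : ∀ j, E d j,
      HasMeanLE P (fun w => ‖quasiGrad O w y N - gradSample O w N (O.f N (y (N + 1)))‖ ^ 2)
        (B * ∑ i ∈ Finset.Icc 1 N, ‖y i - O.f i (y (i + 1))‖ ^ 2) := by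
    rcases Nat.eq_zero_or_pos N with rfl | hN
    · exact ⟨0, le_rfl, fun y => by
        simpa [quasiGrad, gradSample] using hasMeanLE_const (μ := P) 0⟩
    · obtain ⟨B, hB, hb⟩ := h.exists_bias_outer hN le_rfl
      refine ⟨B, hB, fun y => (hb y _).trans (le_of_eq ?_)⟩
      rw [← Finset.Ico_insert_right hN, Finset.sum_insert (by simp)]
  have hC := (h.pos N le_rfl).1.le
  refine ⟨C N * B, by positivity, fun y hy => ?_⟩
  have h1 := (h.inner_grad_bound _ hy).mul
    (Z := fun w => ‖quasiGrad O w y N - gradSample O w N (O.f N (y (N + 1)))‖ ^ 2)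
    ((measurable_grad_eval O N _).norm.pow_const 2) (fun w => by positivity) hC
    ((continuous_norm.pow 2).measurable.comp (measurable_quasiGrad_sub y N _))
    (fun w => by positivity) (hb y)
  refine (h1.of_le ?_ (Filter.Eventually.of_forall fun w => by positivity)
    (Filter.Eventually.of_forall fun w => ?_)).trans (le_of_eq (by ring))
  · exact ((continuous_norm.pow 2).measurable.comp
      ((measurable_quasiGrad_sub y (N + 1) _).mono (lowerLevels_le _) le_rfl)).aestronglyMeasurable
  · simp only [quasiGrad, gradSample]
    rw [← map_sub, ← mul_pow]
    exact pow_le_pow_left₀ (norm_nonneg _) ((O.grad N (w N) _).le_opNorm _) 2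

theorem BasicAssumption.hasMeanLE_direction (h : BasicAssumption O N X P C V L)
    {y : ∀ j, E d j} (hy : y (N + 1) ∈ X) :
    HasMeanLE P (fun w => ‖quasiGrad O w y (N + 1)‖ ^ 2) (∏ i ∈ Finset.range (N + 1), C i) := by
  refine hasMeanLE_quasiGrad (n := N + 1) y (fun i hi => ⟨(h.pos i (by omega)).1.le, ?_⟩) _ le_rfl
  rcases (Nat.lt_succ_iff.1 hi).lt_or_eq with hi' | rfl
  · exact h.outer_grad_bound i hi' _
  · exact h.inner_grad_bound _ hy

theorem FourthMomentAssumption.hasMeanLE_direction (h : FourthMomentAssumption O N X P C V)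
    {y : ∀ j, E d j} (hy : y (N + 1) ∈ X) :
    HasMeanLE P (fun w => ‖quasiGrad O w y (N + 1)‖ ^ 4)
      (∏ i ∈ Finset.range (N + 1), C i ^ 2) := by
  refine hasMeanLE_quasiGrad (n := N + 1) y (fun i hi => ⟨sq_nonneg _, ?_⟩) _ le_rfl
  rcases (Nat.lt_succ_iff.1 hi).lt_or_eq with hi' | rfl
  · exact h.outer_grad_bound i hi' _
  · exact h.inner_grad_bound _ hy

theorem integrable_of_sq {H : Type*} [NormedAddCommGroup H] {Ω : Type*} [MeasurableSpace Ω]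
    {μ : Measure Ω} [IsProbabilityMeasure μ] {g : Ω → H} {c : ℝ} (hg : AEStronglyMeasurable g μ)
    (h : HasMeanLE μ (fun o => ‖g o‖ ^ 2) c) : Integrable g μ :=
  (integrable_norm_iff hg).1 (HasMeanLE.of_sq hg.norm (fun _ => norm_nonneg _) h).1

variable (X O N) in
/-- The point of the optimal set nearest to `x`. -/
noncomputable abbrev optProj (x : E d (N + 1)) : E d (N + 1) := proj (optimalSet X (objective O (N + 1))) x

omit [IsProbabilityMeasure P] in
theorem quasiGrad_congr (w : SamplePath W)
    {y y' : ∀ j, E d j} {j : ℕ} (h : ∀ i ∈ Set.Icc 1 j, y i = y' i) :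
    quasiGrad O w y j = quasiGrad O w y' j := by
  induction j with
  | zero => rfl
  | succ j ih =>
    simp only [quasiGrad]
    rw [ih fun i hi => h i ⟨hi.1, hi.2.trans j.le_succ⟩, h (j + 1) ⟨by omega, le_rfl⟩]

omit [IsProbabilityMeasure P] in
-- Choosing for `y` the exact inner values transfers the moment bounds for quasi-gradients to the
-- sample gradients.
theorem exists_quasiGrad_eq_gradSample (j : ℕ) (x : E d j) :
    ∃ y : ∀ i, E d i, y j = x ∧ ∀ w, gradSample O w j x = quasiGrad O w y j := by
  induction j with
  | zero => exact ⟨Function.update (fun _ => 0) 0 x, by simp, fun w => rfl⟩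
  | succ j ih =>
    obtain ⟨y, -, hy⟩ := ih (O.f j x)
    refine ⟨Function.update y (j + 1) x, by simp, fun w => ?_⟩
    simp only [gradSample, quasiGrad, Function.update_self]
    rw [hy, quasiGrad_congr (y' := Function.update y (j + 1) x) w fun i hi =>
      (Function.update_of_ne (by have := hi.2; omega) _ _).symm]

omit [IsProbabilityMeasure P] in
theorem BasicAssumption.optProj_mem (h : BasicAssumption O N X P C V L) (x : E d (N + 1)) :
    optProj O N X x ∈ optimalSet X (objective O (N + 1)) :=
  (proj_spec h.exists_optimal (isClosed_optimalSet h.closed h.continuous_objective) x).1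

omit [IsProbabilityMeasure P] in
/-- Optimal strong convexity, in terms of the mean of the sample gradients. -/
theorem BasicAssumption.mul_sq_le_inner (h : BasicAssumption O N X P C V L) {lam : ℝ}
    (hlam : OptimallyStronglyConvex X (objective O (N + 1)) lam) {x : E d (N + 1)} (hx : x ∈ X) :
    lam * ‖x - optProj O N X x‖ ^ 2
      ≤ ⟪x - optProj O N X x, ∫ w, gradSample O w (N + 1) x ∂P⟫ := by
  refine (hlam.2 x hx).trans ?_
  have := h.grad_unbiased x hx _ (h.optProj_mem x).1
  rw [← neg_sub x, inner_neg_right, real_inner_comm] at this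
  linarith

/-- Under optimal strong convexity and bounded subgradients, feasible points are at a bounded
distance from the optimal set. -/
theorem BasicAssumption.norm_sub_optProj_le (h : BasicAssumption O N X P C V L) {lam : ℝ}
    (hlam : OptimallyStronglyConvex X (objective O (N + 1)) lam) {x : E d (N + 1)} (hx : x ∈ X) :
    ‖x - optProj O N X x‖ ≤ √(∏ i ∈ Finset.range (N + 1), C i) / lam := by
  obtain ⟨y, hyx, hy⟩ := exists_quasiGrad_eq_gradSample (O := O) (N + 1) x
  have h1 := h.mul_sq_le_inner hlam hx
  have h2 : ‖∫ w, gradSample O w (N + 1) x ∂P‖ ≤ √(∏ i ∈ Finset.range (N + 1), C i) := by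
    simp only [hy]
    have hm := h.hasMeanLE_direction (y := y) (hyx ▸ hx)
    refine (norm_integral_le_integral_norm _).trans (HasMeanLE.of_sq ?_ ?_ hm).2
    · exact (((measurable_quasiGrad O y (N + 1)).mono (lowerLevels_le _)
        le_rfl).norm).aestronglyMeasurable
    · exact fun _ => norm_nonneg _
  have h3 := real_inner_le_norm (x - optProj O N X x) (∫ w, gradSample O w (N + 1) x ∂P)
  rw [le_div_iff₀ hlam.1]
  have h4 := mul_le_mul_of_nonneg_left h2 (norm_nonneg (x - optProj O N X x))
  rcases (norm_nonneg (x - optProj O N X x)).eq_or_lt with h5 | h5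
  · rw [← h5]; simp
  · refine le_of_mul_le_mul_left ?_ h5
    nlinarith

/-- One step of the quasi-gradient iteration, for a frozen state. -/
theorem BasicAssumption.exists_main_step (h : BasicAssumption O N X P C V L) {lam : ℝ}
    (hlam : OptimallyStronglyConvex X (objective O (N + 1)) lam) :
    ∃ B M, 0 ≤ B ∧ 0 ≤ M ∧ ∀ (α : ℝ) (y : ∀ j, E d j), 0 ≤ α → y (N + 1) ∈ X →
      HasMeanLE P (fun w => ‖y (N + 1) - optProj O N X (y (N + 1))
          - α • quasiGrad O w y (N + 1)‖ ^ 2)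
        ((1 - 3 / 2 * (lam * α)) * ‖y (N + 1) - optProj O N X (y (N + 1))‖ ^ 2
          + B * α * (∑ i ∈ Finset.Icc 1 N, ‖y i - O.f i (y (i + 1))‖ ^ 2) + M * α ^ 2) := by
  obtain ⟨B, hB, hb⟩ := h.exists_bias
  have hl := hlam.1
  refine ⟨2 * B / lam, ∏ i ∈ Finset.range (N + 1), C i, by positivity,
    Finset.prod_nonneg fun i hi => (h.pos i (by have := Finset.mem_range.1 hi; omega)).1.le,
    fun α y hα hy => ?_⟩
  have hq : Integrable (fun w => quasiGrad O w y (N + 1)) P :=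
    integrable_of_sq ((measurable_quasiGrad O y (N + 1)).mono (lowerLevels_le _)
      le_rfl).aestronglyMeasurable (h.hasMeanLE_direction hy)
  have hS := h.grad_integrable _ hy
  refine (hasMeanLE_norm_sub_smul_sq hq (h.hasMeanLE_direction hy) _ α).trans ?_
  have hΔ : 0 ≤ ∑ i ∈ Finset.Icc 1 N, ‖y i - O.f i (y (i + 1))‖ ^ 2 :=
    Finset.sum_nonneg fun i _ => by positivity
  have hbias : ‖∫ w, (quasiGrad O w y (N + 1) - gradSample O w (N + 1) (y (N + 1))) ∂P‖
      ≤ √(B * ∑ i ∈ Finset.Icc 1 N, ‖y i - O.f i (y (i + 1))‖ ^ 2) :=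
    (norm_integral_le_integral_norm _).trans
      (HasMeanLE.of_sq (hq.sub hS).1.norm (fun _ => norm_nonneg _) (hb y hy)).2
  rw [integral_sub hq hS] at hbias
  have h1 := h.mul_sq_le_inner hlam hy
  have hBΔ := Real.sq_sqrt (mul_nonneg hB hΔ)
  set Δ := ∑ i ∈ Finset.Icc 1 N, ‖y i - O.f i (y (i + 1))‖ ^ 2
  set e := y (N + 1) - optProj O N X (y (N + 1))
  set q := ∫ w, quasiGrad O w y (N + 1) ∂P
  set g := ∫ w, gradSample O w (N + 1) (y (N + 1)) ∂P
  set r := √(B * Δ)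
  have h2 : -(‖e‖ * r) ≤ ⟪e, q - g⟫ := by
    have h3 := (abs_le.1 (abs_real_inner_le_norm e (q - g))).1
    have h4 := mul_le_mul_of_nonneg_left hbias (norm_nonneg e)
    linarith
  rw [inner_sub_right] at h2
  -- Young's inequality, weighted so that the bias costs `lam / 2` out of the available `2 * lam`;
  -- this leaves the factor `3 / 2`.
  have h5 : 2 * (‖e‖ * r) ≤ lam / 2 * ‖e‖ ^ 2 + 2 * B / lam * Δ := by
    rw [show 2 * B / lam * Δ = 2 / lam * r ^ 2 by rw [hBΔ]; ring]
    have h6 : lam / 2 * ‖e‖ ^ 2 + 2 / lam * r ^ 2 - 2 * (‖e‖ * r)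
        = (lam / 2) * (‖e‖ - 2 / lam * r) ^ 2 := by
      field_simp
      ring
    have h7 : 0 ≤ (lam / 2) * (‖e‖ - 2 / lam * r) ^ 2 := by positivity
    linarith
  have h8 := mul_le_mul_of_nonneg_left h5 hα
  have h9 := mul_le_mul_of_nonneg_left (add_le_add h1 h2) hα
  nlinarith

end Oracle

/-! ### From a frozen state to the random state -/

section Transfer

variable {Ω S Z : Type*} [MeasurableSpace Ω] [MeasurableSpace S] [MeasurableSpace Z]
  {μ : Measure Ω} [IsProbabilityMeasure μ] {P : Measure Z} [IsProbabilityMeasure P]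

/-- A conditional moment bound for each frozen value of the state `Y` integrates to a moment bound
when the sample `s` is independent of the state. -/
theorem HasMeanLE.of_indepFun {Y : Ω → S} {s : Ω → Z} (hY : Measurable Y) (hs : Measurable s)
    (hlaw : μ.map s = P) (hind : IndepFun Y s μ) {h : S → Z → ℝ}
    (hm : Measurable (Function.uncurry h)) (h0 : ∀ y w, 0 ≤ h y w) {g : S → ℝ}
    (hstep : ∀ o, HasMeanLE P (h (Y o)) (g (Y o))) {c : ℝ}
    (hg : HasMeanLE μ (fun o => g (Y o)) c) : HasMeanLE μ (fun o => h (Y o) (s o)) c := by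
  have hg0 : ∀ o, 0 ≤ g (Y o) := fun o => (hstep o).nonneg (h0 _)
  refine hasMeanLE_of_lintegral (hm.comp (hY.prodMk hs)).aestronglyMeasurable (fun o => h0 _ _)
    (hg.nonneg hg0) ?_
  have hmE : Measurable fun p : S × Z => ENNReal.ofReal (h p.1 p.2) :=
    ENNReal.measurable_ofReal.comp hm
  have hmap := (indepFun_iff_map_prod_eq_prod_map_map hY.aemeasurable hs.aemeasurable).1 hind
  calc ∫⁻ o, ENNReal.ofReal (h (Y o) (s o)) ∂μ
      = ∫⁻ p, ENNReal.ofReal (h p.1 p.2) ∂(μ.map fun o => (Y o, s o)) :=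
        (lintegral_map hmE (hY.prodMk hs)).symm
    _ = ∫⁻ y, ∫⁻ w, ENNReal.ofReal (h y w) ∂P ∂(μ.map Y) := by
        rw [hmap, hlaw, lintegral_prod _ hmE.aemeasurable]
    -- Returning to `Ω` before estimating means that the bound is needed only at attained states,
    -- which are feasible, and that `g` need not be measurable on `S`.
    _ = ∫⁻ o, ∫⁻ w, ENNReal.ofReal (h (Y o) w) ∂P ∂μ :=
        lintegral_map hmE.lintegral_prod_right' hY
    _ ≤ ∫⁻ o, ENNReal.ofReal (g (Y o)) ∂μ :=
        lintegral_mono fun o => (hstep o).lintegral_le (h0 _)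
    _ ≤ ENNReal.ofReal c := hg.lintegral_le hg0

end Transfer

/-! ### Polynomial rates of expectations -/

section Rates

variable {Ω : Type*} [MeasurableSpace Ω] {μ : Measure Ω}

/-- The expectations of the `f k` are finite, and of order `k^{-r}`. -/
def HasRate (μ : Measure Ω) (f : ℕ → Ω → ℝ) (r : ℝ) : Prop :=
  (∀ k, Integrable (f k) μ) ∧ ∃ K, 0 ≤ K ∧ ∀ k : ℕ, 1 ≤ k → ∫ o, f k o ∂μ ≤ K * (k : ℝ) ^ (-r)

theorem HasRate.of_le {f g : ℕ → Ω → ℝ} {r r' : ℝ} (hg : HasRate μ g r)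
    (hf : ∀ k, AEStronglyMeasurable (f k) μ) (hf0 : ∀ k o, 0 ≤ f k o) {c : ℕ → ℝ} {c' : ℝ}
    (hc' : 0 ≤ c') (hfg : ∀ k o, f k o ≤ c k * g k o)
    (hc : ∀ k : ℕ, 1 ≤ k → 0 ≤ c k ∧ c k * (k : ℝ) ^ (-r) ≤ c' * (k : ℝ) ^ (-r')) :
    HasRate μ f r' := by
  obtain ⟨hi, K, hK, hb⟩ := hg
  have hfi : ∀ k, Integrable (f k) μ := fun k =>
    ((hi k).const_mul (c k)).mono' (hf k) (Filter.Eventually.of_forall fun o => by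
      rw [Real.norm_of_nonneg (hf0 k o)]; exact hfg k o)
  refine ⟨hfi, K * c', by positivity, fun k hk => ?_⟩
  calc ∫ o, f k o ∂μ ≤ ∫ o, c k * g k o ∂μ := integral_mono (hfi k) ((hi k).const_mul _) (hfg k)
    _ = c k * ∫ o, g k o ∂μ := integral_const_mul _ _
    _ ≤ c k * (K * (k : ℝ) ^ (-r)) := mul_le_mul_of_nonneg_left (hb k hk) (hc k hk).1
    _ = K * (c k * (k : ℝ) ^ (-r)) := by ring
    _ ≤ K * (c' * (k : ℝ) ^ (-r')) := mul_le_mul_of_nonneg_left (hc k hk).2 hK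
    _ = _ := by ring

theorem HasRate.of_pow_four [IsProbabilityMeasure μ] {f : ℕ → Ω → ℝ} {r : ℝ}
    (hf : ∀ k, AEStronglyMeasurable (f k) μ) (h : HasRate μ (fun k o => f k o ^ 4) r) :
    HasRate μ (fun k o => f k o ^ 2) (r / 2) := by
  obtain ⟨hi, K, hK, hb⟩ := h
  have key : ∀ k c, ∫ o, f k o ^ 4 ∂μ ≤ c → HasMeanLE μ (fun o => f k o ^ 2) (√c) := by
    intro k c hc
    refine HasMeanLE.of_sq ((hf k).pow 2) (fun o => sq_nonneg _) ?_
    simp only [← pow_mul]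
    exact ⟨hi k, hc⟩
  refine ⟨fun k => (key k _ le_rfl).1, √K, Real.sqrt_nonneg _, fun k hk => ?_⟩
  refine (key k _ (hb k hk)).2.trans (le_of_eq ?_)
  rw [Real.sqrt_mul hK, Real.sqrt_eq_rpow ((k : ℝ) ^ (-r)), ← Real.rpow_mul (Nat.cast_nonneg k)]
  ring_nf

end Rates

/-! ### Tracking at a single level: error recursion, fourth moments, increments -/

section Level

variable {Ω Z H H' : Type*} [MeasurableSpace Ω] [MeasurableSpace Z]
  [NormedAddCommGroup H] [InnerProductSpace ℝ H] [CompleteSpace H] [MeasurableSpace H]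
  [BorelSpace H] [SecondCountableTopology H]
  [NormedAddCommGroup H'] [NormedSpace ℝ H'] [MeasurableSpace H'] [BorelSpace H']
  [SecondCountableTopology H']

/-- The tracking sequence `y` of one level: `y` follows `F (u k)`, where the samples of `F` are
taken at the query points `z k`. -/
structure IsTracking (μ : Measure Ω) (P : Measure Z) (F : H' → H) (val : Z → H' → H)
    (β : ℕ → ℝ) (y : ℕ → Ω → H) (u z : ℕ → Ω → H') (t : ℕ → Ω → Z) (K v₂ v₄ : ℝ) : Prop where
  rec_eq : ∀ k o, y (k + 1) o = (1 - β k) • y k o + β k • val (t k o) (z k o)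
  beta_pos : ∀ k, 0 < β k
  lipschitz : ∀ x x', ‖F x - F x'‖ ≤ K * ‖x - x'‖
  lipschitz_nonneg : 0 ≤ K
  measurable_val : Measurable (Function.uncurry val)
  noise_integrable : ∀ k o, Integrable (fun w => val w (z k o) - F (z k o)) P
  noise_mean : ∀ k o, ∫ w, (val w (z k o) - F (z k o)) ∂P = 0
  noise_two : ∀ k o, HasMeanLE P (fun w => ‖val w (z k o) - F (z k o)‖ ^ 2) v₂
  noise_four : ∀ k o, HasMeanLE P (fun w => ‖val w (z k o) - F (z k o)‖ ^ 4) v₄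
  -- A common bound for the two kinds of query: the left side is `β ‖u' - u‖` for the basic one and
  -- `‖u' - u‖` for the extrapolated one.
  query : ∀ k o, ‖β k • (z k o - u k o)‖ ≤ (1 + β k) * ‖u (k + 1) o - u k o‖
  measurable_y : ∀ k, Measurable (y k)
  measurable_u : ∀ k, Measurable (u k)
  measurable_z : ∀ k, Measurable (z k)
  measurable_t : ∀ k, Measurable (t k)
  law : ∀ k, μ.map (t k) = P
  -- The new target `u (k + 1)` belongs to the state, since it is computed before the sample for
  -- this level is drawn.
  indep : ∀ k, IndepFun (fun o => (y k o, u k o, u (k + 1) o, z k o)) (t k) μ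
  init : Integrable (fun o => ‖y 0 o - F (u 0 o)‖ ^ 4) μ

namespace IsTracking

variable {μ : Measure Ω} [IsProbabilityMeasure μ] {P : Measure Z} [IsProbabilityMeasure P]
  {F : H' → H} {val : Z → H' → H} {β : ℕ → ℝ} {y : ℕ → Ω → H} {u z : ℕ → Ω → H'}
  {t : ℕ → Ω → Z} {K v₂ v₄ : ℝ}

/-- The displacement of the target that is not matched by the query. -/
def drift (F : H' → H) (β : ℝ) (u u' z : H') : H := β • (F z - F u) - (F u' - F u)

theorem measurable_F (h : IsTracking μ P F val β y u z t K v₂ v₄) : Measurable F :=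
  (LipschitzWith.of_dist_le_mul (K := K.toNNReal) fun x x' => by
    rw [dist_eq_norm, dist_eq_norm, Real.coe_toNNReal _ h.lipschitz_nonneg]
    exact h.lipschitz x x').continuous.measurable

theorem error_succ (h : IsTracking μ P F val β y u z t K v₂ v₄) (k : ℕ) (o : Ω) :
    y (k + 1) o - F (u (k + 1) o)
      = ((1 - β k) • (y k o - F (u k o)) + drift F (β k) (u k o) (u (k + 1) o) (z k o))
        + β k • (val (t k o) (z k o) - F (z k o)) := by
  rw [h.rec_eq, drift]
  module

theorem diff_eq (h : IsTracking μ P F val β y u z t K v₂ v₄) (k : ℕ) (o : Ω) :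
    y (k + 1) o - y k o
      = ((-β k) • (y k o - F (u k o)) + β k • (F (z k o) - F (u k o)))
        + β k • (val (t k o) (z k o) - F (z k o)) := by
  rw [h.rec_eq]
  module

theorem norm_smul_sub_le (h : IsTracking μ P F val β y u z t K v₂ v₄) (k : ℕ) (o : Ω) :
    ‖β k • (F (z k o) - F (u k o))‖ ≤ K * (1 + β k) * ‖u (k + 1) o - u k o‖ := by
  have h1 := h.query k o
  have h2 := h.lipschitz (z k o) (u k o)
  rw [norm_smul, Real.norm_of_nonneg (h.beta_pos k).le] at *
  nlinarith [mul_le_mul_of_nonneg_left h2 (h.beta_pos k).le,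
    mul_le_mul_of_nonneg_left h1 h.lipschitz_nonneg]

theorem norm_drift_le (h : IsTracking μ P F val β y u z t K v₂ v₄) (k : ℕ) (o : Ω) :
    ‖drift F (β k) (u k o) (u (k + 1) o) (z k o)‖
      ≤ K * (2 + β k) * ‖u (k + 1) o - u k o‖ := by
  have h1 := h.norm_smul_sub_le k o
  have h2 := h.lipschitz (u (k + 1) o) (u k o)
  refine (norm_sub_le _ _).trans ?_
  nlinarith

theorem measurable_error (h : IsTracking μ P F val β y u z t K v₂ v₄) (k : ℕ) :
    Measurable fun o => y k o - F (u k o) :=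
  (h.measurable_y k).sub (h.measurable_F.comp (h.measurable_u k))

theorem measurable_drift (h : IsTracking μ P F val β y u z t K v₂ v₄) (k : ℕ) :
    Measurable fun o => drift F (β k) (u k o) (u (k + 1) o) (z k o) := by
  have hF := h.measurable_F
  have h1 := hF.comp (h.measurable_u k)
  have h2 := hF.comp (h.measurable_u (k + 1))
  have h3 := hF.comp (h.measurable_z k)
  exact ((h3.sub h1).const_smul (β k)).sub (h2.sub h1)

/-- The transfer of a moment bound for `‖A + β ξ‖ ^ m`, where `ξ` is the noise of the sample. -/
theorem hasMeanLE_error_succ (h : IsTracking μ P F val β y u z t K v₂ v₄) (m k : ℕ)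
    {g : H → ℝ} {c : ℝ}
    (hstep : ∀ A o, HasMeanLE P (fun w => ‖A + β k • (val w (z k o) - F (z k o))‖ ^ m) (g A))
    (hg : HasMeanLE μ (fun o => g ((1 - β k) • (y k o - F (u k o))
      + drift F (β k) (u k o) (u (k + 1) o) (z k o))) c) :
    HasMeanLE μ (fun o => ‖y (k + 1) o - F (u (k + 1) o)‖ ^ m) c := by
  have hF := h.measurable_F
  simp only [h.error_succ]
  refine HasMeanLE.of_indepFun (Y := fun o => (y k o, u k o, u (k + 1) o, z k o))
    (h := fun Y w => ‖((1 - β k) • (Y.1 - F Y.2.1) + drift F (β k) Y.2.1 Y.2.2.1 Y.2.2.2)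
        + β k • (val w Y.2.2.2 - F Y.2.2.2)‖ ^ m)
    (g := fun Y => g ((1 - β k) • (Y.1 - F Y.2.1) + drift F (β k) Y.2.1 Y.2.2.1 Y.2.2.2))
    ((h.measurable_y k).prodMk ((h.measurable_u k).prodMk
      ((h.measurable_u (k + 1)).prodMk (h.measurable_z k))))
    (h.measurable_t k) (h.law k) (h.indep k) ?_ (fun _ _ => by positivity)
    (fun o => hstep _ o) hg
  have hv := h.measurable_val
  refine Measurable.pow_const (Measurable.norm ?_) m
  have m0 : Measurable fun p : (H × H' × H' × H') × Z => p.1.1 := by fun_prop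
  have m1 : Measurable fun p : (H × H' × H' × H') × Z => F p.1.2.1 := hF.comp (by fun_prop)
  have m2 : Measurable fun p : (H × H' × H' × H') × Z => F p.1.2.2.1 := hF.comp (by fun_prop)
  have m3 : Measurable fun p : (H × H' × H' × H') × Z => F p.1.2.2.2 := hF.comp (by fun_prop)
  have m4 : Measurable fun p : (H × H' × H' × H') × Z => val p.2 p.1.2.2.2 :=
    hv.comp (f := fun p : (H × H' × H' × H') × Z => (p.2, p.1.2.2.2)) (by fun_prop)
  exact (((m0.sub m1).const_smul (1 - β k)).add (((m3.sub m1).const_smul (β k)).sub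
    (m2.sub m1))).add ((m4.sub m3).const_smul (β k))

theorem hasMeanLE_noise (h : IsTracking μ P F val β y u z t K v₂ v₄) (k : ℕ) :
    HasMeanLE μ (fun o => ‖val (t k o) (z k o) - F (z k o)‖ ^ 4) v₄ := by
  have hv := h.measurable_val
  refine HasMeanLE.of_indepFun (Y := z k) (h := fun x w => ‖val w x - F x‖ ^ 4)
    (g := fun _ => v₄) (h.measurable_z k) (h.measurable_t k) (h.law k)
    ((h.indep k).comp (φ := fun p : H × H' × H' × H' => p.2.2.2) (ψ := id) (by fun_prop)
      measurable_id) ?_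
    (fun _ _ => by positivity) (fun o => h.noise_four k o) (hasMeanLE_const _)
  refine Measurable.pow_const (Measurable.norm (Measurable.sub ?_ ?_)) 4
  · exact hv.comp (f := fun p : H' × Z => (p.2, p.1)) (by fun_prop)
  · exact h.measurable_F.comp measurable_fst

theorem integrable_drift (h : IsTracking μ P F val β y u z t K v₂ v₄)
    {r : ℝ} (hu : HasRate μ (fun k o => ‖u (k + 1) o - u k o‖ ^ 4) r) (k : ℕ) :
    Integrable (fun o => ‖drift F (β k) (u k o) (u (k + 1) o) (z k o)‖ ^ 4) μ := by
  refine ((hu.1 k).const_mul ((K * (2 + β k)) ^ 4)).mono'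
    ((h.measurable_drift k).norm.pow_const 4).aestronglyMeasurable
    (Filter.Eventually.of_forall fun o => ?_)
  rw [Real.norm_of_nonneg (by positivity), ← mul_pow]
  exact pow_le_pow_left₀ (norm_nonneg _) (h.norm_drift_le k o) 4

theorem integrable_sq_of_pow_four {f : Ω → ℝ} (hf : Measurable f)
    (h : Integrable (fun o => f o ^ 4) μ) : Integrable (fun o => f o ^ 2) μ := by
  refine ((integrable_const (1 : ℝ)).add h).mono' (hf.pow_const 2).aestronglyMeasurable
    (Filter.Eventually.of_forall fun o => ?_)
  rw [Real.norm_of_nonneg (sq_nonneg _)]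
  simp only [Pi.add_apply]
  nlinarith [sq_nonneg (f o ^ 2 - 1)]

/-- The first stepsizes may exceed `1`, where the convexity estimate fails; finiteness at every
index therefore rests on the cruder inequality `norm_add_pow_four_le`. -/
theorem integrable_error (h : IsTracking μ P F val β y u z t K v₂ v₄)
    {r : ℝ} (hu : HasRate μ (fun k o => ‖u (k + 1) o - u k o‖ ^ 4) r) (k : ℕ) :
    Integrable (fun o => ‖y k o - F (u k o)‖ ^ 4) μ := by
  induction k with
  | zero => exact h.init
  | succ k ih =>
    have hA : Integrable (fun o => ‖(1 - β k) • (y k o - F (u k o))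
        + drift F (β k) (u k o) (u (k + 1) o) (z k o)‖ ^ 4) μ := by
      refine (((ih.const_mul ((1 - β k) ^ 4)).add (h.integrable_drift hu k)).const_mul 8).mono'
        ((((h.measurable_error k).const_smul (1 - β k)).add
          (h.measurable_drift k)).norm.pow_const 4).aestronglyMeasurable
        (Filter.Eventually.of_forall fun o => ?_)
      rw [Real.norm_of_nonneg (by positivity)]
      refine (norm_add_pow_four_le _ _).trans (le_of_eq ?_)
      rw [norm_smul, mul_pow, Real.norm_eq_abs, ← abs_pow,
        abs_of_nonneg (by positivity : 0 ≤ (1 - β k) ^ 4)]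
      rfl
    have hA2 := integrable_sq_of_pow_four (((h.measurable_error k).const_smul (1 - β k)).add
          (h.measurable_drift k)).norm hA
    exact (h.hasMeanLE_error_succ 4 k (fun A o => hasMeanLE_norm_add_smul_four
      (h.noise_integrable k o) (h.noise_mean k o) (h.noise_two k o) (h.noise_four k o) A (β k))
      ⟨(hA.add ((hA2.const_mul 8).mul_const _)).add (integrable_const _), le_rfl⟩).1

theorem exists_beta_le_one {b c : ℝ} (hb : 0 < b)
    (hβ : ∀ k : ℕ, 1 ≤ k → β k = c * (k : ℝ) ^ (-b)) :
    ∃ k₀ : ℕ, 1 ≤ k₀ ∧ ∀ k, k₀ ≤ k → β k ≤ 1 := by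
  obtain ⟨k₀, h1, hk⟩ := eventually_mul_rpow_neg_le c hb one_pos
  exact ⟨k₀, h1, fun k h => (hβ k (h1.trans h)).trans_le (hk k h)⟩

/-- The mixed noise term takes half of the contraction, as `(1 + β / 2) (1 - β) ≤ 1 - β / 2`. The
constant `162` is `2 * 3 ^ 4`: the drift is at most `3 K` times the increment when `β ≤ 1`, and `1 +
β / 2 ≤ 2`. -/
theorem integral_pow_four_succ_le (h : IsTracking μ P F val β y u z t K v₂ v₄)
    {r : ℝ} (hu : HasRate μ (fun k o => ‖u (k + 1) o - u k o‖ ^ 4) r) {k : ℕ} (h1 : β k ≤ 1) :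
    ∫ o, ‖y (k + 1) o - F (u (k + 1) o)‖ ^ 4 ∂μ
      ≤ (1 - 1 / 2 * β k) * ∫ o, ‖y k o - F (u k o)‖ ^ 4 ∂μ
        + (162 * K ^ 4 * ((∫ o, ‖u (k + 1) o - u k o‖ ^ 4 ∂μ) / β k ^ 4) + 32 * v₂ ^ 2 + 3 * v₄)
          * β k := by
  have hb := h.beta_pos k
  obtain ⟨o₀⟩ : Nonempty Ω := nonempty_of_isProbabilityMeasure μ
  have hv₄ : 0 ≤ v₄ := (h.noise_four k o₀).nonneg fun _ => by positivity
  have hδ := h.integrable_error hu k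
  refine (h.hasMeanLE_error_succ 4 k
    (g := fun A => 2 * (‖A‖ ^ 4 * ((1 + β k / 2) / 2)) + (32 * v₂ ^ 2 + 3 * v₄) * β k)
    (fun A o => (hasMeanLE_norm_add_smul_four (h.noise_integrable k o) (h.noise_mean k o)
      (h.noise_two k o) (h.noise_four k o) A (β k)).trans ?_)
    (HasMeanLE.of_le (g := fun o => (1 - 1 / 2 * β k) * ‖y k o - F (u k o)‖ ^ 4
      + 162 * K ^ 4 * (‖u (k + 1) o - u k o‖ ^ 4 / β k ^ 4) * β k
      + (32 * v₂ ^ 2 + 3 * v₄) * β k) (c := (1 - 1 / 2 * β k)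
        * (∫ o, ‖y k o - F (u k o)‖ ^ 4 ∂μ) + 162 * K ^ 4 * β k / β k ^ 4
        * (∫ o, ‖u (k + 1) o - u k o‖ ^ 4 ∂μ) + (32 * v₂ ^ 2 + 3 * v₄) * β k) ?_ ?_ ?_ ?_)).2.trans
    (le_of_eq (by ring))
  -- The difference of the two sides is `(β / 2) (‖A‖² - 8 β v₂)²`.
  · have e1 : 8 * ‖A‖ ^ 2 * (β k ^ 2 * v₂) ≤ β k / 2 * ‖A‖ ^ 4 + 32 * v₂ ^ 2 * β k ^ 3 := by
      nlinarith [mul_nonneg hb.le (sq_nonneg (‖A‖ ^ 2 - 8 * β k * v₂))]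
    have e2 : β k ^ 3 ≤ β k := by
      have := pow_le_pow_of_le_one hb.le h1 (show 1 ≤ 3 by norm_num)
      simpa using this
    have e3 : β k ^ 4 ≤ β k := by
      have := pow_le_pow_of_le_one hb.le h1 (show 1 ≤ 4 by norm_num)
      simpa using this
    nlinarith [mul_le_mul_of_nonneg_left e2 (sq_nonneg v₂), mul_le_mul_of_nonneg_left e3 hv₄]
  · have i1 := HasMeanLE.const_mul ⟨hδ, le_rfl⟩ (by linarith : 0 ≤ 1 - 1 / 2 * β k)
    have i2 := HasMeanLE.const_mul ⟨hu.1 k, le_rfl⟩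
      (by positivity : 0 ≤ 162 * K ^ 4 * β k / β k ^ 4)
    refine ((i1.add i2).add (hasMeanLE_const _)).of_le ?_ ?_ ?_
    · exact ((((h.measurable_error k).norm.pow_const 4).const_mul _).add
        ((((((h.measurable_u (k + 1)).sub (h.measurable_u k)).norm.pow_const 4).div_const
          _).const_mul _).mul_const _)).add_const _ |>.aestronglyMeasurable
    · refine Filter.Eventually.of_forall fun o => ?_
      have := sq_nonneg v₂
      have : 0 ≤ 1 - 1 / 2 * β k := by linarith
      positivity
    · exact Filter.Eventually.of_forall fun o => le_of_eq (by ring)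
  · refine Measurable.aestronglyMeasurable ?_
    have := ((h.measurable_error k).const_smul (1 - β k)).add (h.measurable_drift k)
    exact (((this.norm.pow_const 4).mul_const _).const_mul 2).add_const _
  · refine Filter.Eventually.of_forall fun o => ?_
    have := sq_nonneg v₂
    positivity
  · refine Filter.Eventually.of_forall fun o => ?_
    have e1 := norm_add_pow_le_convex 4 hb h1 (y k o - F (u k o))
      (drift F (β k) (u k o) (u (k + 1) o) (z k o))
    have e2 : ‖drift F (β k) (u k o) (u (k + 1) o) (z k o)‖ ^ 4
        ≤ 81 * K ^ 4 * ‖u (k + 1) o - u k o‖ ^ 4 := by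
      have : ‖drift F (β k) (u k o) (u (k + 1) o) (z k o)‖ ≤ K * 3 * ‖u (k + 1) o - u k o‖ := by
        refine (h.norm_drift_le k o).trans ?_
        have := h.lipschitz_nonneg
        gcongr
        linarith
      refine (pow_le_pow_left₀ (norm_nonneg _) this 4).trans (le_of_eq (by ring))
    have e3 := div_le_div_of_nonneg_right e2 (by positivity : 0 ≤ β k ^ 4)
    rw [div_pow] at e1
    have e4 := mul_le_mul_of_nonneg_left e3 hb.le
    have e5 : 0 ≤ ‖y k o - F (u k o)‖ ^ 4 := by positivity
    have e6 : 0 ≤ 81 * K ^ 4 * ‖u (k + 1) o - u k o‖ ^ 4 / β k ^ 4 := by positivity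
    rw [show 162 * K ^ 4 * (‖u (k + 1) o - u k o‖ ^ 4 / β k ^ 4)
      = 2 * (81 * K ^ 4 * ‖u (k + 1) o - u k o‖ ^ 4 / β k ^ 4) by ring]
    set A := ‖(1 - β k) • (y k o - F (u k o))
      + drift F (β k) (u k o) (u (k + 1) o) (z k o)‖ ^ 4
    set D := ‖y k o - F (u k o)‖ ^ 4
    set U := 81 * K ^ 4 * ‖u (k + 1) o - u k o‖ ^ 4 / β k ^ 4
    have e7 : A ≤ (1 - β k) * D + β k * U := e1.trans (by linarith)
    have e8 := mul_le_mul_of_nonneg_left e7 (by positivity : 0 ≤ 1 + β k / 2)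
    have e9 : 0 ≤ β k * β k * D := by positivity
    have e10 : β k * (β k * U) ≤ 1 * (β k * U) := by gcongr
    nlinarith

/-- Increments of fourth moment `O(k^{-4b})` are exactly those for which the ratio to `β ^ 4` stays
bounded, so the forcing is of the order `β` of the contraction. -/
theorem exists_pow_four_bound (h : IsTracking μ P F val β y u z t K v₂ v₄) {b c : ℝ}
    (hb : 0 < b) (hc : 0 < c) (hβ : ∀ k : ℕ, 1 ≤ k → β k = c * (k : ℝ) ^ (-b))
    (hu : HasRate μ (fun k o => ‖u (k + 1) o - u k o‖ ^ 4) (4 * b)) :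
    ∃ M, ∀ k, ∫ o, ‖y k o - F (u k o)‖ ^ 4 ∂μ ≤ M := by
  obtain ⟨k₀, hk₀, hβ1⟩ := exists_beta_le_one hb hβ
  obtain ⟨-, B, hB, hub⟩ := id hu
  refine bounded_of_recursion (β := β) (c := 1 / 2) (k₀ := k₀)
    (K := 162 * K ^ 4 * (B / c ^ 4) + 32 * v₂ ^ 2 + 3 * v₄) (by norm_num)
    (fun k hk => ⟨(h.beta_pos k).le, by linarith [hβ1 k hk]⟩) fun k hk => ?_
  have hk1 := hk₀.trans hk
  refine (h.integral_pow_four_succ_le hu (hβ1 k hk)).trans ?_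
  have h1 : (∫ o, ‖u (k + 1) o - u k o‖ ^ 4 ∂μ) / β k ^ 4 ≤ B / c ^ 4 := by
    have hkp : (0 : ℝ) < k := by exact_mod_cast hk1
    have hx : (k : ℝ) ^ (-(4 * b)) = ((k : ℝ) ^ (-b)) ^ 4 := by
      rw [← Real.rpow_natCast, ← Real.rpow_mul hkp.le]
      congr 1
      push_cast
      ring
    have hx0 : 0 < (k : ℝ) ^ (-b) := Real.rpow_pos_of_pos hkp _
    rw [hβ k hk1, mul_pow, div_le_div_iff₀ (by positivity) (by positivity)]
    have := hub k hk1
    rw [hx] at this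
    calc _ ≤ B * ((k : ℝ) ^ (-b)) ^ 4 * c ^ 4 := by gcongr
      _ = _ := by ring
  have := (h.beta_pos k).le
  gcongr

/-- After division by `β`, the squared drift is of order `k^{-b} k^{-q}`; the noise `β² v₂` is too
because `q ≤ b`. The contraction constant `c ≥ 1` exceeds `q` because `q ≤ b < 1`. -/
theorem rate_error (h : IsTracking μ P F val β y u z t K v₂ v₄) {b c q : ℝ}
    (hb : 0 < b) (hb1 : b < 1) (hc : 1 ≤ c) (hβ : ∀ k : ℕ, 1 ≤ k → β k = c * (k : ℝ) ^ (-b))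
    (hq : 0 < q) (hqb : q ≤ b)
    (hu : HasRate μ (fun k o => ‖u (k + 1) o - u k o‖ ^ 4) (4 * b))
    (hd : HasRate μ (fun k o => ‖drift F (β k) (u k o) (u (k + 1) o) (z k o)‖ ^ 2) (2 * b + q)) :
    HasRate μ (fun k o => ‖y k o - F (u k o)‖ ^ 2) q := by
  obtain ⟨k₀, hk₀, hβ1⟩ := exists_beta_le_one hb hβ
  have hi : ∀ k, Integrable (fun o => ‖y k o - F (u k o)‖ ^ 2) μ := fun k =>
    integrable_sq_of_pow_four (h.measurable_error k).norm (h.integrable_error hu k)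
  obtain ⟨hdi, B, hB, hdb⟩ := hd
  obtain ⟨o₀⟩ : Nonempty Ω := nonempty_of_isProbabilityMeasure μ
  have hv₂ : 0 ≤ v₂ := (h.noise_two 0 o₀).nonneg fun _ => by positivity
  obtain ⟨K', hK'⟩ := rate_of_recursion (u := fun k => ∫ o, ‖y k o - F (u k o)‖ ^ 2 ∂μ)
    (p := b) (q := q) (c := c) (K := B / c + c ^ 2 * v₂) (k₀ := k₀) hb hb1.le hq (by linarith)
    fun k hk => by
      have hk1 := hk₀.trans hk
      have hkp : (0 : ℝ) < k := by exact_mod_cast hk1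
      have hx0 : 0 < (k : ℝ) ^ (-b) := Real.rpow_pos_of_pos hkp _
      have hy0 : 0 < (k : ℝ) ^ (-q) := Real.rpow_pos_of_pos hkp _
      have hxy : (k : ℝ) ^ (-b) ≤ (k : ℝ) ^ (-q) :=
        Real.rpow_le_rpow_of_exponent_le (by exact_mod_cast hk1) (by linarith)
      have hd' := hdb k hk1
      rw [show -(2 * b + q) = -b + -b + -q by ring, Real.rpow_add hkp, Real.rpow_add hkp] at hd'
      have hbk := h.beta_pos k
      have step := (h.hasMeanLE_error_succ 2 k (g := fun A => ‖A‖ ^ 2 + β k ^ 2 * v₂)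
        (fun A o => hasMeanLE_norm_add_smul_sq (h.noise_integrable k o) (h.noise_mean k o)
          (h.noise_two k o) A (β k))
        (HasMeanLE.of_le (g := fun o => (1 - β k) * ‖y k o - F (u k o)‖ ^ 2
          + (β k)⁻¹ * ‖drift F (β k) (u k o) (u (k + 1) o) (z k o)‖ ^ 2 + β k ^ 2 * v₂)
          (((HasMeanLE.const_mul ⟨hi k, le_rfl⟩ (by linarith [hβ1 k hk])).add
            (HasMeanLE.const_mul ⟨hdi k, le_rfl⟩ (inv_pos.2 hbk).le)).add (hasMeanLE_const _))
          (Measurable.aestronglyMeasurable ((((((h.measurable_error k).const_smul (1 - β k)).add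
            (h.measurable_drift k)).norm).pow_const 2).add_const _))
          (Filter.Eventually.of_forall fun o => by positivity)
          (Filter.Eventually.of_forall fun o => by
            have e1 := norm_add_pow_le_convex 2 hbk (hβ1 k hk) (y k o - F (u k o))
              (drift F (β k) (u k o) (u (k + 1) o) (z k o))
            have e2 : β k * (‖drift F (β k) (u k o) (u (k + 1) o) (z k o)‖ / β k) ^ 2
                = (β k)⁻¹ * ‖drift F (β k) (u k o) (u (k + 1) o) (z k o)‖ ^ 2 := by
              field_simp
            linarith))).2
      refine step.trans ?_
      have e3 := mul_le_mul_of_nonneg_left hd' (inv_pos.2 hbk).le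
      rw [hβ k hk1] at *
      have e4 : (c * (k : ℝ) ^ (-b))⁻¹ * (B * ((k : ℝ) ^ (-b) * (k : ℝ) ^ (-b) * (k : ℝ) ^ (-q)))
          = B / c * ((k : ℝ) ^ (-b) * (k : ℝ) ^ (-q)) := by
        have : c ≠ 0 := by linarith
        field_simp
      have e5 : (c * (k : ℝ) ^ (-b)) ^ 2 * v₂
          ≤ c ^ 2 * v₂ * ((k : ℝ) ^ (-b) * (k : ℝ) ^ (-q)) := by
        calc _ = c ^ 2 * v₂ * ((k : ℝ) ^ (-b) * (k : ℝ) ^ (-b)) := by ring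
          _ ≤ _ := by gcongr
      linarith
  refine ⟨hi, max K' 0, le_max_right _ _, fun k hk => (hK' k hk).trans ?_⟩
  gcongr
  exact le_max_left _ _

/-- An increment consists of `β` times the old error, `β` times the noise, and a query term
controlled by the increment of the target. The first two have bounded fourth moments before scaling,
so all three are of order `k^{-4b}`. -/
theorem rate_diff (h : IsTracking μ P F val β y u z t K v₂ v₄) {b c : ℝ}
    (hb : 0 < b) (hc : 0 < c) (hβ : ∀ k : ℕ, 1 ≤ k → β k = c * (k : ℝ) ^ (-b))
    (hu : HasRate μ (fun k o => ‖u (k + 1) o - u k o‖ ^ 4) (4 * b)) :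
    HasRate μ (fun k o => ‖y (k + 1) o - y k o‖ ^ 4) (4 * b) := by
  obtain ⟨M, hM⟩ := h.exists_pow_four_bound hb hc hβ hu
  have hM0 : 0 ≤ M := (integral_nonneg fun o => by positivity).trans (hM 0)
  obtain ⟨hui, B, hB, hub⟩ := id hu
  obtain ⟨o₀⟩ : Nonempty Ω := nonempty_of_isProbabilityMeasure μ
  have hv₄ : 0 ≤ v₄ := (h.noise_four 0 o₀).nonneg fun _ => by positivity
  have key : ∀ k, HasMeanLE μ (fun o => ‖y (k + 1) o - y k o‖ ^ 4)
      (64 * β k ^ 4 * M + 64 * (K * (1 + β k)) ^ 4 * (∫ o, ‖u (k + 1) o - u k o‖ ^ 4 ∂μ)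
        + 8 * β k ^ 4 * v₄) := by
    intro k
    have hbk := h.beta_pos k
    have h1 : HasMeanLE μ (fun o => ‖y k o - F (u k o)‖ ^ 4) M := ⟨h.integrable_error hu k, hM k⟩
    have h2 : HasMeanLE μ (fun o => ‖u (k + 1) o - u k o‖ ^ 4) _ := ⟨hui k, le_rfl⟩
    refine ((h1.const_mul (by positivity : 0 ≤ 64 * β k ^ 4)).add
      (h2.const_mul (by positivity : 0 ≤ 64 * (K * (1 + β k)) ^ 4))).add
      ((h.hasMeanLE_noise k).const_mul (by positivity : 0 ≤ 8 * β k ^ 4)) |>.of_le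
      (((h.measurable_y (k + 1)).sub (h.measurable_y k)).norm.pow_const 4).aestronglyMeasurable
      (Filter.Eventually.of_forall fun o => by positivity)
      (Filter.Eventually.of_forall fun o => ?_)
    rw [h.diff_eq]
    have e1 := norm_add_pow_four_le ((-β k) • (y k o - F (u k o))
      + β k • (F (z k o) - F (u k o))) (β k • (val (t k o) (z k o) - F (z k o)))
    have e2 := norm_add_pow_four_le ((-β k) • (y k o - F (u k o))) (β k • (F (z k o) - F (u k o)))
    have e3 := pow_le_pow_left₀ (norm_nonneg _) (h.norm_smul_sub_le k o) 4
    rw [mul_pow] at e3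
    rw [norm_smul (-β k), norm_neg, mul_pow, Real.norm_of_nonneg hbk.le] at e2
    rw [norm_smul (β k) (val _ _ - _), mul_pow, Real.norm_of_nonneg hbk.le] at e1
    linarith
  refine ⟨fun k => (key k).1, 64 * c ^ 4 * M + 64 * (K * (1 + c)) ^ 4 * B + 8 * c ^ 4 * v₄,
    by positivity, fun k hk => (key k).2.trans ?_⟩
  have hkp : (0 : ℝ) < k := by exact_mod_cast hk
  have hx : (k : ℝ) ^ (-(4 * b)) = ((k : ℝ) ^ (-b)) ^ 4 := by
    rw [← Real.rpow_natCast, ← Real.rpow_mul hkp.le]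
    congr 1
    push_cast
    ring
  have hβ4 : β k ^ 4 = c ^ 4 * (k : ℝ) ^ (-(4 * b)) := by rw [hβ k hk, hx, mul_pow]
  have hβc : β k ≤ c := by
    rw [hβ k hk]
    exact mul_le_of_le_one_right hc.le
      (Real.rpow_le_one_of_one_le_of_nonpos (by exact_mod_cast hk) (by linarith))
  have hbk := h.beta_pos k
  have hK := h.lipschitz_nonneg
  have e1 : 64 * (K * (1 + β k)) ^ 4 * (∫ o, ‖u (k + 1) o - u k o‖ ^ 4 ∂μ)
      ≤ 64 * (K * (1 + c)) ^ 4 * (B * (k : ℝ) ^ (-(4 * b))) := by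
    have := hub k hk
    gcongr
  rw [hβ4]
  linarith

end IsTracking

end Level

/-! ### Size of the drift for basic and extrapolated queries -/

section QueryRates

namespace IsTracking

variable {Ω Z H H' : Type*} [MeasurableSpace Ω] [MeasurableSpace Z]
  [NormedAddCommGroup H] [InnerProductSpace ℝ H] [CompleteSpace H] [MeasurableSpace H]
  [BorelSpace H] [SecondCountableTopology H]
  [NormedAddCommGroup H'] [NormedSpace ℝ H'] [MeasurableSpace H'] [BorelSpace H']
  [SecondCountableTopology H']
  {μ : Measure Ω} [IsProbabilityMeasure μ] {P : Measure Z} [IsProbabilityMeasure P]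
  {F : H' → H} {val : Z → H' → H} {β : ℕ → ℝ} {y : ℕ → Ω → H} {u z : ℕ → Ω → H'}
  {t : ℕ → Ω → Z} {K v₂ v₄ : ℝ}

theorem rate_mono {f : ℕ → Ω → ℝ} {r r' : ℝ} (h : HasRate μ f r) (hr : r' ≤ r) :
    HasRate μ f r' := by
  obtain ⟨hi, B, hB, hb⟩ := h
  refine ⟨hi, B, hB, fun k hk => (hb k hk).trans ?_⟩
  gcongr
  exact_mod_cast hk

/-- Lipschitz continuity alone gives a squared drift of order `k^{-2p}`, hence the requirement `2p ≥
2b + q`. -/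
theorem rate_drift_basic (h : IsTracking μ P F val β y u z t K v₂ v₄) {b c p q : ℝ}
    (hb : 0 < b) (hc : 0 < c) (hβ : ∀ k : ℕ, 1 ≤ k → β k = c * (k : ℝ) ^ (-b))
    (hq : q ≤ 2 * (p - b))
    (hu : HasRate μ (fun k o => ‖u (k + 1) o - u k o‖ ^ 4) (4 * p)) :
    HasRate μ (fun k o => ‖drift F (β k) (u k o) (u (k + 1) o) (z k o)‖ ^ 2) (2 * b + q) := by
  have hu2 := HasRate.of_pow_four (fun k =>
    ((h.measurable_u (k + 1)).sub (h.measurable_u k)).norm.aestronglyMeasurable) hu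
  have hK := h.lipschitz_nonneg
  refine hu2.of_le (fun k => ((h.measurable_drift k).norm.pow_const 2).aestronglyMeasurable)
    (fun _ _ => by positivity) (c := fun k => (K * (2 + β k)) ^ 2) (c' := (K * (2 + c)) ^ 2)
    (by positivity) (fun k o => ?_) fun k hk => ⟨by positivity, ?_⟩
  · rw [← mul_pow]
    exact pow_le_pow_left₀ (norm_nonneg _) (h.norm_drift_le k o) 2
  · have hβc : β k ≤ c := by
      rw [hβ k hk]
      exact mul_le_of_le_one_right hc.le
        (Real.rpow_le_one_of_one_le_of_nonpos (by exact_mod_cast hk) (by linarith))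
    have := (h.beta_pos k).le
    have hk' : (1 : ℝ) ≤ k := by exact_mod_cast hk
    gcongr
    linarith

/-- Since `β (z - u) = u' - u`, the derivative terms cancel and two second-order Taylor remainders
are left. The squared drift is of order `β^{-2} ‖u' - u‖⁴`, that is `k^{2b - 4p}`, hence the
requirement `4p - 2b ≥ 2b + q`. -/
theorem rate_drift_extrapolate (h : IsTracking μ P F val β y u z t K v₂ v₄) {b c p q L : ℝ}
    (hb : 0 < b) (hc : 1 ≤ c) (hβ : ∀ k : ℕ, 1 ≤ k → β k = c * (k : ℝ) ^ (-b))
    (hq : q ≤ 4 * (p - b)) (hL : 0 ≤ L) (hF : Differentiable ℝ F)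
    (hFL : ∀ x x', ‖fderiv ℝ F x - fderiv ℝ F x'‖ ≤ L * ‖x - x'‖)
    (hz : ∀ k o, z k o = extrapolate (β k) (u k o) (u (k + 1) o))
    (hu : HasRate μ (fun k o => ‖u (k + 1) o - u k o‖ ^ 4) (4 * p)) :
    HasRate μ (fun k o => ‖drift F (β k) (u k o) (u (k + 1) o) (z k o)‖ ^ 2) (2 * b + q) := by
  refine hu.of_le (fun k => ((h.measurable_drift k).norm.pow_const 2).aestronglyMeasurable)
    (fun _ _ => by positivity) (c := fun k => (L * (1 / β k + 1)) ^ 2) (c' := (2 * L) ^ 2)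
    (by positivity) (fun k o => ?_) fun k hk => ⟨by positivity, ?_⟩
  · have hbk := h.beta_pos k
    have e0 : z k o - u k o = (1 / β k) • (u (k + 1) o - u k o) := by
      rw [hz, extrapolate]; module
    have e1 : drift F (β k) (u k o) (u (k + 1) o) (z k o)
        = β k • (F (z k o) - F (u k o) - fderiv ℝ F (u k o) (z k o - u k o))
          - (F (u (k + 1) o) - F (u k o) - fderiv ℝ F (u k o) (u (k + 1) o - u k o)) := by
      rw [drift, e0, map_smul, smul_sub, smul_sub, smul_sub, smul_smul,
        mul_one_div_cancel hbk.ne', one_smul]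
      abel
    have e2 := norm_sub_sub_le_of_fderiv_lipschitz hF hL hFL (z k o) (u k o)
    have e3 := norm_sub_sub_le_of_fderiv_lipschitz hF hL hFL (u (k + 1) o) (u k o)
    have e4 : ‖drift F (β k) (u k o) (u (k + 1) o) (z k o)‖
        ≤ L * (1 / β k + 1) * ‖u (k + 1) o - u k o‖ ^ 2 := by
      rw [e1]
      refine (norm_sub_le _ _).trans ?_
      rw [norm_smul, Real.norm_of_nonneg hbk.le]
      have e5 := mul_le_mul_of_nonneg_left e2 hbk.le
      have e6 : β k * (L * ‖z k o - u k o‖ ^ 2)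
          = L * (1 / β k) * ‖u (k + 1) o - u k o‖ ^ 2 := by
        rw [e0, norm_smul, Real.norm_of_nonneg (by positivity)]
        field_simp
      linarith
    refine (pow_le_pow_left₀ (norm_nonneg _) e4 2).trans (le_of_eq (by ring))
  · have hk' : (1 : ℝ) ≤ k := by exact_mod_cast hk
    have hkp : (0 : ℝ) < k := by linarith
    have e1 : 1 / β k ≤ (k : ℝ) ^ b := by
      rw [hβ k hk, Real.rpow_neg hkp.le, ← div_eq_mul_inv, one_div_div]
      exact div_le_self (by positivity) hc
    have e2 : (1 : ℝ) ≤ (k : ℝ) ^ b := Real.one_le_rpow hk' hb.le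
    have hbk := h.beta_pos k
    calc (L * (1 / β k + 1)) ^ 2 * (k : ℝ) ^ (-(4 * p))
        ≤ (L * ((k : ℝ) ^ b + (k : ℝ) ^ b)) ^ 2 * (k : ℝ) ^ (-(4 * p)) := by gcongr
      _ = (2 * L) ^ 2 * ((k : ℝ) ^ b * (k : ℝ) ^ b * (k : ℝ) ^ (-(4 * p))) := by ring
      _ = (2 * L) ^ 2 * (k : ℝ) ^ (b + b + -(4 * p)) := by
        rw [Real.rpow_add hkp, Real.rpow_add hkp]
      _ ≤ (2 * L) ^ 2 * (k : ℝ) ^ (-(2 * b + q)) := by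
        gcongr
        linarith

end IsTracking

end QueryRates

/-! ### Adaptedness of the iterates and independence of fresh samples -/

section Run

variable {d : ℕ → ℕ} {W : ℕ → Type*} [∀ j, MeasurableSpace (W j)] {O : Oracle d W} {N : ℕ}
  {X : Set (E d (N + 1))} {Ω : Type*} {s : ℕ → ℕ → Ω → SamplePath W}
  {smoothInner : Bool} {α : ℕ → ℝ} {β : ℕ → ℕ → ℝ} {y : ∀ j, ℕ → Ω → E d j}

/-- The point at which level `j + 1` is sampled for updating `y^{(j)}`. -/
noncomputable def queryPoint (N : ℕ) (smoothInner : Bool) (β : ℕ → ℕ → ℝ)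
    (y : ∀ j, ℕ → Ω → E d j) (j k : ℕ) (o : Ω) : E d (j + 1) :=
  if j = N ∧ smoothInner = false then y (j + 1) (k + 1) o
  else extrapolate (β j k) (y (j + 1) k o) (y (j + 1) (k + 1) o)

theorem IsRun.update_eq (h : IsRun O N X s smoothInner α β y) {j : ℕ} (hj : j ∈ Set.Icc 1 N)
    (k : ℕ) (o : Ω) : y j (k + 1) o = (1 - β j k) • y j k o
      + β j k • O.value j (s k j o j) (queryPoint N smoothInner β y j k o) := by
  by_cases hc : j = N ∧ smoothInner = false
  · obtain ⟨rfl, hs⟩ := hc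
    rw [queryPoint, if_pos ⟨rfl, hs⟩]
    exact h.basic hs hj.1 k o
  · rw [queryPoint, if_neg hc]
    refine h.accelerated j hj.1 ?_ k o
    rcases hj.2.lt_or_eq with hlt | rfl
    · exact Or.inl hlt
    · exact Or.inr ⟨rfl, by simpa using hc⟩

/-- The coordinates of `y` that the algorithm does not use may be set to zero. -/
theorem IsRun.truncate (h : IsRun O N X s smoothInner α β y) :
    IsRun O N X s smoothInner α β fun j => if j ∈ Set.Icc 1 (N + 1) then y j else 0 := by
  obtain ⟨⟨y₀, hy₀, hy₀'⟩, hm, hb, ha⟩ := h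
  have e1 : N + 1 ∈ Set.Icc 1 (N + 1) := ⟨by omega, le_rfl⟩
  refine ⟨⟨y₀, hy₀, fun j hj o => ?_⟩, fun k o => ?_, fun hs hN k o => ?_,
    fun j hj hj' k o => ?_⟩
  · rw [if_pos hj]
    exact hy₀' j hj o
  · rw [if_pos e1, hm, quasiGrad_congr (s k (N + 1) o) fun i hi => ?_]
    rw [if_pos hi]
  · rw [if_pos e1, if_pos ⟨hN, N.le_succ⟩]
    exact hb hs hN k o
  · have hjN : j ≤ N := by omega
    rw [if_pos ⟨hj, by omega⟩, if_pos ⟨by omega, by omega⟩]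
    exact ha j hj hj' k o

theorem IsRun.mem (h : IsRun O N X s smoothInner α β y) (hX : IsClosed X) (k : ℕ) (o : Ω) :
    y (N + 1) k o ∈ X := by
  obtain ⟨y₀, hy₀, hy₀'⟩ := h.init
  cases k with
  | zero => rw [hy₀' _ ⟨by omega, le_rfl⟩]; exact hy₀
  | succ k => rw [h.main]; exact (proj_spec ⟨_, hy₀⟩ hX _).1

variable (N s) in
/-- The information before the query that is made in iteration `k` for updating `y^{(j)}`. -/
abbrev past (k j : ℕ) : MeasurableSpace Ω :=
  ⨆ q ∈ {q : ℕ × Set.Icc 1 (N + 1) | q.1 < k ∨ (q.1 = k ∧ j < (q.2 : ℕ))},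
    MeasurableSpace.comap (s q.1 q.2) MeasurableSpace.pi

theorem past_mono {k k' j j' : ℕ}
    (h : ∀ (m : ℕ) (i : Set.Icc 1 (N + 1)), (m < k ∨ (m = k ∧ j < (i : ℕ))) →
      (m < k' ∨ (m = k' ∧ j' < (i : ℕ)))) : past N s k j ≤ past N s k' j' :=
  biSup_mono fun q hq => h q.1 q.2 hq

theorem measurable_sample_past {k j j' : ℕ} (hj : j ∈ Set.Icc 1 (N + 1)) (hj' : j' < j) :
    Measurable[past N s k j'] (s k j) := by
  rw [measurable_iff_comap_le]
  exact le_iSup₂_of_le (f := fun (q : ℕ × Set.Icc 1 (N + 1)) _ =>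
    MeasurableSpace.comap (s q.1 q.2) MeasurableSpace.pi) (k, ⟨j, hj⟩) (Or.inr ⟨rfl, hj'⟩) le_rfl

variable [MeasurableSpace Ω] {μ : Measure Ω} [IsProbabilityMeasure μ] {P : Measure (SamplePath W)}
  [IsProbabilityMeasure P]

theorem SamplePaths.past_le (hs : SamplePaths μ (N + 1) P s) (k j : ℕ) :
    past N s k j ≤ ‹MeasurableSpace Ω› :=
  iSup₂_le fun q _ => (hs.measurable q.1 q.2 q.2.2).comap_le

theorem SamplePaths.indepFun (hs : SamplePaths μ (N + 1) P s) {k j : ℕ}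
    (hj : j ∈ Set.Icc 1 (N + 1)) {S : Type*} [MeasurableSpace S] {Y : Ω → S}
    (hY : Measurable[past N s k j] Y) : IndepFun Y (s k j) μ := by
  have hdisj : Disjoint {q : ℕ × Set.Icc 1 (N + 1) | q.1 < k ∨ (q.1 = k ∧ j < (q.2 : ℕ))}
      {(k, ⟨j, hj⟩)} := by
    rw [Set.disjoint_singleton_right]
    simp
  have h1 := indep_iSup_of_disjoint (fun q : ℕ × Set.Icc 1 (N + 1) =>
    (hs.measurable q.1 q.2 q.2.2).comap_le) hs.indep hdisj
  rw [iSup_singleton] at h1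
  exact indep_of_indep_of_le_left h1 hY.comap_le

theorem BasicAssumption.measurable_proj {C V L : ℕ → ℝ} (h : BasicAssumption O N X P C V L) :
    Measurable (proj X) := by
  obtain ⟨x, hx⟩ := h.exists_optimal
  exact (continuous_proj ⟨x, hx.1⟩ h.closed h.convex).measurable

theorem measurable_queryPoint {m : MeasurableSpace Ω} {j k : ℕ}
    (h1 : Measurable (y (j + 1) k)) (h2 : Measurable (y (j + 1) (k + 1))) :
    Measurable (queryPoint N smoothInner β y j k) := by
  unfold queryPoint
  split_ifs
  · exact h2
  · exact (h1.const_smul (1 - 1 / β j k)).add (h2.const_smul (1 / β j k))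

/-- Within an iteration the updates run from level `N + 1` down to `1`, and `y j (k + 1)` uses the
queries of levels `j` and above; `past N s k (j - 1)` is the information that includes the query for
`j`. The auxiliary `m` counts the levels already descended. -/
theorem IsRun.measurable_past {C V L : ℕ → ℝ} (h : IsRun O N X s smoothInner α β y)
    (hb : BasicAssumption O N X P C V L) (hy : ∀ j, j ∉ Set.Icc 1 (N + 1) → y j = 0) (k : ℕ) :
    (∀ j, Measurable[past N s k (N + 1)] (y j k)) ∧
      ∀ m j, 1 ≤ j → j + m = N + 1 → Measurable[past N s k (j - 1)] (y j (k + 1)) := by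
  have hstep : ∀ k, (∀ j, Measurable[past N s k (N + 1)] (y j k)) →
      ∀ m j, 1 ≤ j → j + m = N + 1 → Measurable[past N s k (j - 1)] (y j (k + 1)) := by
    intro k hk m
    induction m with
    | zero =>
      rintro j - rfl
      have hle : past N s k (N + 1) ≤ past N s k N := past_mono fun m i hi => by omega
      have h1 : ∀ j, Measurable[past N s k N] (y j k) := fun j => (hk j).mono hle le_rfl
      have h2 : Measurable[past N s k N] (fun o j => y j k o) :=
        @measurable_pi_lambda _ _ _ (past N s k N) _ _ h1
      have h3 : Measurable[past N s k N] (s k (N + 1)) :=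
        measurable_sample_past ⟨by omega, le_rfl⟩ N.lt_succ_self
      have h4 : Measurable[past N s k N]
          fun o => quasiGrad O (s k (N + 1) o) (fun j => y j k o) (N + 1) :=
        (measurable_quasiGrad_joint O (N + 1)).comp (h3.prodMk h2)
      rw [show y (N + 1) (k + 1) = fun o => proj X (y (N + 1) k o
        - α k • quasiGrad O (s k (N + 1) o) (fun j => y j k o) (N + 1)) from funext (h.main k)]
      exact hb.measurable_proj.comp ((h1 (N + 1)).sub (h4.const_smul (α k)))
    | succ m ih =>
      intro j hj hjm
      have h1 : Measurable[past N s k (j - 1)] (y (j + 1) (k + 1)) :=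
        (ih (j + 1) (by omega) (by omega)).mono (past_mono fun m i hi => by omega) le_rfl
      have hle : past N s k (N + 1) ≤ past N s k (j - 1) := past_mono fun m i hi => by omega
      have h2 := (hk j).mono hle le_rfl
      have h3 := (hk (j + 1)).mono hle le_rfl
      have h4 : Measurable[past N s k (j - 1)] (queryPoint N smoothInner β y j k) :=
        measurable_queryPoint h3 h1
      have h5 : Measurable[past N s k (j - 1)] (s k j) :=
        measurable_sample_past ⟨by omega, by omega⟩ (by omega)
      rw [show y j (k + 1) = fun o => (1 - β j k) • y j k o + β j k • O.value j (s k j o j)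
        (queryPoint N smoothInner β y j k o) from funext (h.update_eq ⟨hj, by omega⟩ k)]
      exact (h2.const_smul (1 - β j k)).add (((O.measurable_value j).comp
        (((measurable_eval_level j).comp h5).prodMk h4)).const_smul (β j k))
  have hall : ∀ k, ∀ j, Measurable[past N s k (N + 1)] (y j k) := by
    intro k
    induction k with
    | zero =>
      intro j
      by_cases hj : j ∈ Set.Icc 1 (N + 1)
      · obtain ⟨y₀, -, hy₀⟩ := h.init
        rw [show y j 0 = fun _ => y₀ j from funext (hy₀ j hj)]
        exact measurable_const
      · rw [hy j hj]
        exact measurable_const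
    | succ k ih =>
      intro j
      by_cases hj : j ∈ Set.Icc 1 (N + 1)
      · exact (hstep k ih (N + 1 - j) j hj.1 (by have := hj.2; omega)).mono
          (past_mono fun m i hi => by omega) le_rfl
      · rw [hy j hj]
        exact measurable_const
  exact ⟨hall k, hstep k (hall k)⟩

theorem IsRun.measurable {C V L : ℕ → ℝ} (h : IsRun O N X s smoothInner α β y)
    (hb : BasicAssumption O N X P C V L) (hs : SamplePaths μ (N + 1) P s)
    (hy : ∀ j, j ∉ Set.Icc 1 (N + 1) → y j = 0) (j k : ℕ) : Measurable (y j k) :=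
  ((h.measurable_past hb hy k).1 j).mono (hs.past_le _ _) le_rfl

end Run

/-! ### Rates at all levels and convergence of the main iterate -/

section Convergence

variable {d : ℕ → ℕ} {W : ℕ → Type*} [∀ j, MeasurableSpace (W j)] {O : Oracle d W} {N : ℕ}
  {X : Set (E d (N + 1))} {Ω : Type*} {s : ℕ → ℕ → Ω → SamplePath W}
  {smoothInner : Bool} {α : ℕ → ℝ} {β : ℕ → ℕ → ℝ} {y : ∀ j, ℕ → Ω → E d j}
  [MeasurableSpace Ω] {μ : Measure Ω} [IsProbabilityMeasure μ] {P : Measure (SamplePath W)}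
  [IsProbabilityMeasure P] {C V L : ℕ → ℝ}

theorem hasMeanLE_noise_queryPoint (hb : BasicAssumption O N X P C V L)
    (h4 : FourthMomentAssumption O N X P C V)
    (hsm : smoothInner = true → SmoothInnerAssumption O N P V L)
    (hr : IsRun O N X s smoothInner α β y) {j : ℕ} (hj : j ∈ Set.Icc 1 N) (k : ℕ) (o : Ω) :
    HasMeanLE P (fun w => ‖O.value j (w j) (queryPoint N smoothInner β y j k o)
        - O.f j (queryPoint N smoothInner β y j k o)‖ ^ 2) (V j) ∧
      HasMeanLE P (fun w => ‖O.value j (w j) (queryPoint N smoothInner β y j k o)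
        - O.f j (queryPoint N smoothInner β y j k o)‖ ^ 4) (V j ^ 2) := by
  rcases hj.2.lt_or_eq with hlt | rfl
  · exact ⟨(hb.outer_value_bound j hlt _).hasMeanLE, (h4.outer_value_bound j hlt _).hasMeanLE⟩
  · cases smoothInner with
    | true => exact ⟨((hsm rfl).value_bound _).hasMeanLE, ((hsm rfl).value_bound_four _).hasMeanLE⟩
    | false =>
      have hx := hr.mem hb.closed (k + 1) o
      rw [queryPoint, if_pos ⟨rfl, rfl⟩]
      exact ⟨(hb.inner_value_bound _ hx).hasMeanLE, (h4.inner_value_bound _ hx).hasMeanLE⟩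

theorem IsRun.isTracking (hr : IsRun O N X s smoothInner α β y)
    (hb : BasicAssumption O N X P C V L) (h4 : FourthMomentAssumption O N X P C V)
    (hsm : smoothInner = true → SmoothInnerAssumption O N P V L)
    (hs : SamplePaths μ (N + 1) P s) (hy : ∀ j, j ∉ Set.Icc 1 (N + 1) → y j = 0)
    {j : ℕ} (hj : j ∈ Set.Icc 1 N) (hβ : ∀ k, 0 < β j k) :
    ∃ K, IsTracking μ P (O.f j) (fun w x => O.value j (w j) x) (β j) (y j) (y (j + 1))
      (queryPoint N smoothInner β y j) (fun k => s k j) K (V j) (V j ^ 2) := by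
  obtain ⟨K, hK, hlip⟩ := hb.exists_lipschitz hj.2
  have hm := hr.measurable hb hs hy
  have hj' : j ∈ Set.Icc 1 (N + 1) := ⟨hj.1, hj.2.trans N.le_succ⟩
  have hj'' : j + 1 ∈ Set.Icc 1 (N + 1) := ⟨by omega, by have := hj.2; omega⟩
  refine ⟨K, ?_⟩
  constructor
  · exact fun k o => hr.update_eq hj k o
  · exact hβ
  · exact hlip
  · exact hK
  · exact (O.measurable_value j).comp
      (((measurable_eval_level j).comp measurable_fst).prodMk measurable_snd)
  · exact fun k o => hb.integrable_noise hj.2 _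
  · exact fun k o => hb.integral_noise hj.2 _
  · exact fun k o => (hasMeanLE_noise_queryPoint hb h4 hsm hr hj k o).1
  · exact fun k o => (hasMeanLE_noise_queryPoint hb h4 hsm hr hj k o).2
  · intro k o
    have hbk := hβ k
    unfold queryPoint
    split_ifs
    · rw [norm_smul, Real.norm_of_nonneg hbk.le]
      exact mul_le_mul_of_nonneg_right (by linarith) (norm_nonneg _)
    · have : β j k • (extrapolate (β j k) (y (j + 1) k o) (y (j + 1) (k + 1) o) - y (j + 1) k o)
          = (β j k * (1 / β j k)) • (y (j + 1) (k + 1) o - y (j + 1) k o) := by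
        rw [extrapolate]; module
      rw [this, mul_one_div_cancel hbk.ne', one_smul]
      exact le_mul_of_one_le_left (norm_nonneg _) (by linarith)
  · exact hm j
  · exact hm (j + 1)
  · exact fun k => measurable_queryPoint (hm _ _) (hm _ _)
  · exact fun k => hs.measurable k j hj'
  · exact fun k => hs.law k j hj'
  · intro k
    refine hs.indepFun hj' ?_
    obtain ⟨hk, hk'⟩ := hr.measurable_past hb hy k
    have hle : past N s k (N + 1) ≤ past N s k j :=
      past_mono fun m i hi => by have := hj'.2; omega
    have h1 := (hk j).mono hle le_rfl
    have h2 := (hk (j + 1)).mono hle le_rfl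
    have h3 : Measurable[past N s k j] (y (j + 1) (k + 1)) :=
      hk' (N - j) (j + 1) (by omega) (by have := hj.2; omega)
    exact h1.prodMk (h2.prodMk (h3.prodMk (measurable_queryPoint h2 h3)))
  · obtain ⟨y₀, -, hy₀⟩ := hr.init
    simp only [hy₀ j hj', hy₀ (j + 1) hj'']
    exact integrable_const _

theorem IsRun.hasMeanLE_main (hr : IsRun O N X s smoothInner α β y)
    (hb : BasicAssumption O N X P C V L) (hs : SamplePaths μ (N + 1) P s)
    (hy : ∀ j, j ∉ Set.Icc 1 (N + 1) → y j = 0) (k : ℕ)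
    {h : (∀ j, E d j) → SamplePath W → ℝ} (hm : Measurable (Function.uncurry h))
    (h0 : ∀ y w, 0 ≤ h y w) {g : (∀ j, E d j) → ℝ}
    (hstep : ∀ y : ∀ j, E d j, y (N + 1) ∈ X → HasMeanLE P (h y) (g y)) {c : ℝ}
    (hg : HasMeanLE μ (fun o => g fun j => y j k o) c) :
    HasMeanLE μ (fun o => h (fun j => y j k o) (s k (N + 1) o)) c := by
  have hN : N + 1 ∈ Set.Icc 1 (N + 1) := ⟨by omega, le_rfl⟩
  refine HasMeanLE.of_indepFun (Y := fun o j => y j k o)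
    (measurable_pi_lambda _ fun j => hr.measurable hb hs hy j k) (hs.measurable k _ hN)
    (hs.law k _ hN) (hs.indepFun hN ?_) hm h0 (fun o => hstep _ (hr.mem hb.closed k o)) hg
  exact @measurable_pi_lambda _ _ _ (past N s k (N + 1)) _ _ (hr.measurable_past hb hy k).1

theorem measurable_quasiGrad_state :
    Measurable fun p : (∀ j, E d j) × SamplePath W => quasiGrad O p.2 p.1 (N + 1) :=
  (measurable_quasiGrad_joint O (N + 1)).comp measurable_swap

theorem IsRun.rate_main_diff (hr : IsRun O N X s smoothInner α β y)
    (hb : BasicAssumption O N X P C V L) (h4 : FourthMomentAssumption O N X P C V)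
    (hs : SamplePaths μ (N + 1) P s) (hy : ∀ j, j ∉ Set.Icc 1 (N + 1) → y j = 0)
    {a l : ℝ} (hα : ∀ k : ℕ, 1 ≤ k → α k = l * (k : ℝ) ^ (-a)) :
    HasRate μ (fun k o => ‖y (N + 1) (k + 1) o - y (N + 1) k o‖ ^ 4) (4 * a) := by
  set M := ∏ i ∈ Finset.range (N + 1), C i ^ 2 with hM
  have hM0 : 0 ≤ M := Finset.prod_nonneg fun i _ => sq_nonneg _
  obtain ⟨x₀, hx₀, -⟩ := hb.exists_optimal
  have key : ∀ k, HasMeanLE μ (fun o => ‖y (N + 1) (k + 1) o - y (N + 1) k o‖ ^ 4)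
      (α k ^ 4 * M) := by
    intro k
    simp only [hr.main]
    refine hr.hasMeanLE_main hb hs hy k
      (h := fun y w => ‖proj X (y (N + 1) - α k • quasiGrad O w y (N + 1)) - y (N + 1)‖ ^ 4)
      (g := fun _ => α k ^ 4 * M) ?_ (fun _ _ => by positivity) (fun y hyX => ?_)
      (hasMeanLE_const _)
    · have m1 : Measurable fun p : (∀ j, E d j) × SamplePath W => p.1 (N + 1) :=
        (measurable_pi_apply _).comp measurable_fst
      exact ((hb.measurable_proj.comp (m1.sub
        (measurable_quasiGrad_state.const_smul (α k)))).sub m1).norm.pow_const 4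
    · refine ((h4.hasMeanLE_direction hyX).const_mul
        (by positivity : 0 ≤ α k ^ 4)).of_le ?_
        (Filter.Eventually.of_forall fun w => by positivity)
        (Filter.Eventually.of_forall fun w => ?_)
      · have m2 : Measurable fun w : SamplePath W => quasiGrad O w y (N + 1) :=
          (measurable_quasiGrad O y (N + 1)).mono (lowerLevels_le _) le_rfl
        exact ((hb.measurable_proj.comp (measurable_const.sub
          (m2.const_smul (α k)))).sub_const _).norm.pow_const 4 |>.aestronglyMeasurable
      · have := norm_proj_sub_proj_le ⟨x₀, hx₀⟩ hb.closed hb.convex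
          (y (N + 1) - α k • quasiGrad O w y (N + 1)) (y (N + 1))
        rw [proj_eq_self hb.closed hyX, sub_sub_cancel_left, norm_neg, norm_smul] at this
        refine (pow_le_pow_left₀ (norm_nonneg _) this 4).trans (le_of_eq ?_)
        rw [mul_pow, Real.norm_eq_abs, ← abs_pow, abs_of_nonneg (by positivity : 0 ≤ α k ^ 4)]
  refine ⟨fun k => (key k).1, l ^ 4 * M, by positivity, fun k hk => (key k).2.trans ?_⟩
  rw [hα k hk, mul_pow, ← Real.rpow_natCast ((k : ℝ) ^ (-a)), ← Real.rpow_mul (Nat.cast_nonneg k)]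
  refine le_of_eq ?_
  push_cast
  ring_nf

/-- The conditions on the exponents for the rate `n^{-q}`; here `b (N + 1)` is the exponent of the
stepsizes of the main iteration. -/
structure AdmissibleExponents (N : ℕ) (smoothInner : Bool) (b : ℕ → ℝ) (q : ℝ) : Prop where
  pos : 0 < q
  le : ∀ j ∈ Set.Icc 1 (N + 1), q ≤ b j
  le_one : b (N + 1) ≤ 1
  basic : 1 ≤ N → smoothInner = false → q ≤ 2 * (b (N + 1) - b N)
  accelerated : ∀ j ∈ Set.Icc 1 N, ¬(j = N ∧ smoothInner = false) → q ≤ 4 * (b (j + 1) - b j)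

theorem AdmissibleExponents.gap {b : ℕ → ℝ} {q : ℝ} (h : AdmissibleExponents N smoothInner b q)
    {j : ℕ} (hj : j ∈ Set.Icc 1 N) : b j < b (j + 1) := by
  have hq := h.pos
  by_cases hc : j = N ∧ smoothInner = false
  · obtain ⟨rfl, hs⟩ := hc
    linarith [h.basic hj.1 hs]
  · linarith [h.accelerated j hj hc]

/-- Descending induction from the main iterate. What it carries is the fourth-moment rate of the
increments: at full strength it controls the drift of the next level, and weakened to the smaller
exponent `b j` it bounds that level's fourth moments. The tracking rate is read off along the way.
-/
theorem IsRun.rate_levels (hr : IsRun O N X s smoothInner α β y)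
    (hb : BasicAssumption O N X P C V L) (h4 : FourthMomentAssumption O N X P C V)
    (hsm : smoothInner = true → SmoothInnerAssumption O N P V L)
    (hs : SamplePaths μ (N + 1) P s) (hy : ∀ j, j ∉ Set.Icc 1 (N + 1) → y j = 0)
    {b c : ℕ → ℝ} {q l : ℝ} (hα : ∀ k : ℕ, 1 ≤ k → α k = l * (k : ℝ) ^ (-b (N + 1)))
    (hβ0 : ∀ j ∈ Set.Icc 1 N, 0 < β j 0) (hc : ∀ j ∈ Set.Icc 1 N, 1 ≤ c j)
    (hβ : ∀ j ∈ Set.Icc 1 N, ∀ k : ℕ, 1 ≤ k → β j k = c j * (k : ℝ) ^ (-b j))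
    (hq : AdmissibleExponents N smoothInner b q) :
    ∀ m j, 1 ≤ j → j + m = N + 1 → b j ≤ 1 ∧
      HasRate μ (fun k o => ‖y j (k + 1) o - y j k o‖ ^ 4) (4 * b j) ∧
      (j ≤ N → HasRate μ (fun k o => ‖y j k o - O.f j (y (j + 1) k o)‖ ^ 2) q) := by
  intro m
  induction m with
  | zero =>
    rintro j - rfl
    exact ⟨hq.le_one, hr.rate_main_diff hb h4 hs hy hα, fun h => by omega⟩
  | succ m ih =>
    intro j hj hjm
    obtain ⟨h1, hu, -⟩ := ih (j + 1) (by omega) (by omega)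
    have hjN : j ∈ Set.Icc 1 N := ⟨hj, by omega⟩
    have hgap := hq.gap hjN
    have hqj := hq.le j ⟨hj, by omega⟩
    have hq0 := hq.pos
    have hc1 := hc j hjN
    have hβpos : ∀ k, 0 < β j k := by
      intro k
      rcases Nat.eq_zero_or_pos k with rfl | hk
      · exact hβ0 j hjN
      · rw [hβ j hjN k hk]
        have : (0 : ℝ) < k := by exact_mod_cast hk
        positivity
    obtain ⟨K, hT⟩ := hr.isTracking hb h4 hsm hs hy hjN hβpos
    have hu' := IsTracking.rate_mono hu (show 4 * b j ≤ 4 * b (j + 1) by linarith)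
    refine ⟨by linarith, hT.rate_diff (by linarith) (by linarith) (hβ j hjN) hu', fun _ => ?_⟩
    refine hT.rate_error (by linarith) (by linarith) hc1 (hβ j hjN) hq0 hqj hu' ?_
    by_cases hcase : j = N ∧ smoothInner = false
    · refine hT.rate_drift_basic (by linarith) (by linarith) (hβ j hjN) ?_ hu
      obtain ⟨rfl, hs'⟩ := hcase
      exact hq.basic hj hs'
    · refine hT.rate_drift_extrapolate (by linarith) hc1 (hβ j hjN) (hq.accelerated j hjN hcase)
        (hb.pos j hjN.2).2.2.le ?_ ?_ (fun k o => by rw [queryPoint, if_neg hcase]) hu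
      · rcases hjN.2.lt_or_eq with hlt | rfl
        · exact (hb.outer_contDiff j hlt).differentiable one_ne_zero
        · exact (hsm (by simpa using hcase)).differentiable
      · rcases hjN.2.lt_or_eq with hlt | rfl
        · exact hb.outer_smooth j hlt
        · exact (hsm (by simpa using hcase)).smooth

theorem BasicAssumption.measurable_optProj (hb : BasicAssumption O N X P C V L)
    (hconv : ConvexOn ℝ X (objective O (N + 1))) : Measurable (optProj O N X) :=
  (continuous_proj hb.exists_optimal (isClosed_optimalSet hb.closed hb.continuous_objective)
    (convex_optimalSet hconv)).measurable

/-- The squared distances to the optimal set are bounded. -/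
theorem IsRun.exists_bound (hr : IsRun O N X s smoothInner α β y)
    (hb : BasicAssumption O N X P C V L) (hs : SamplePaths μ (N + 1) P s)
    (hconv : ConvexOn ℝ X (objective O (N + 1))) {lam : ℝ}
    (hlam : OptimallyStronglyConvex X (objective O (N + 1)) lam) :
    ∃ D, 0 ≤ D ∧ ∀ k,
      HasMeanLE μ (fun o => ‖y (N + 1) k o - optProj O N X (y (N + 1) k o)‖ ^ 2) D := by
  refine ⟨(√(∏ i ∈ Finset.range (N + 1), C i) / lam) ^ 2, sq_nonneg _, fun k => ?_⟩
  have hm := hr.truncate.measurable hb hs (fun j hj => if_neg hj) (N + 1) k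
  rw [if_pos (Set.right_mem_Icc.2 (Nat.le_add_left 1 N))] at hm
  refine (hasMeanLE_const _).of_le
    ((hm.sub ((hb.measurable_optProj hconv).comp hm)).norm.pow_const 2).aestronglyMeasurable
    (Filter.Eventually.of_forall fun o => by positivity) (Filter.Eventually.of_forall fun o => ?_)
  exact pow_le_pow_left₀ (norm_nonneg _)
    (hb.norm_sub_optProj_le hlam (hr.mem hb.closed k o)) 2

theorem IsRun.meanSquareRate (hr : IsRun O N X s smoothInner α β y)
    (hb : BasicAssumption O N X P C V L) (h4 : FourthMomentAssumption O N X P C V)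
    (hsm : smoothInner = true → SmoothInnerAssumption O N P V L)
    (hs : SamplePaths μ (N + 1) P s) (hconv : ConvexOn ℝ X (objective O (N + 1))) {lam : ℝ}
    (hlam : OptimallyStronglyConvex X (objective O (N + 1)) lam)
    {b c : ℕ → ℝ} {q : ℝ} (hα : ∀ k : ℕ, 1 ≤ k → α k = 1 / lam * (k : ℝ) ^ (-b (N + 1)))
    (hβ0 : ∀ j ∈ Set.Icc 1 N, 0 < β j 0) (hc : ∀ j ∈ Set.Icc 1 N, 1 ≤ c j)
    (hβ : ∀ j ∈ Set.Icc 1 N, ∀ k : ℕ, 1 ≤ k → β j k = c j * (k : ℝ) ^ (-b j))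
    (hq : AdmissibleExponents N smoothInner b q) :
    MeanSquareRate μ (optimalSet X (objective O (N + 1))) (y (N + 1))
      (fun n => (n : ℝ) ^ (-q)) := by
  -- The unused coordinates are arbitrary functions on `Ω`; zeroing them makes the whole state
  -- measurable.
  wlog hy : ∀ j, j ∉ Set.Icc 1 (N + 1) → y j = 0 generalizing y
  · have := this hr.truncate fun j hj => if_neg hj
    rwa [if_pos (Set.right_mem_Icc.2 (Nat.le_add_left 1 N))] at this
  obtain ⟨D, hD, hbound⟩ := hr.exists_bound hb hs hconv hlam
  obtain ⟨B, M, hB, hM, hmain⟩ := hb.exists_main_step hlam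
  have hl := hlam.1
  have hlev : ∀ j ∈ Finset.Icc 1 N,
      HasRate μ (fun k o => ‖y j k o - O.f j (y (j + 1) k o)‖ ^ 2) q := fun j hj => by
    obtain ⟨h1, h2⟩ := Finset.mem_Icc.1 hj
    exact (hr.rate_levels hb h4 hsm hs hy hα hβ0 hc hβ hq (N + 1 - j) j h1 (by omega)).2.2 h2
  choose! hδi A hA hδ using hlev
  have hq0 := hq.pos
  have hqa := hq.le (N + 1) ⟨by omega, le_rfl⟩
  have ha1 := hq.le_one
  set a := b (N + 1)
  -- From `k₀` on, the factor `1 - (3/2) k^{-a}` is nonnegative.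
  obtain ⟨k₀, hk₀, hsmall⟩ := eventually_mul_rpow_neg_le (3 / 2) (hq0.trans_le hqa) one_pos
  obtain ⟨K', hK'⟩ := rate_of_recursion
    (u := fun k => ∫ o, ‖y (N + 1) k o - optProj O N X (y (N + 1) k o)‖ ^ 2 ∂μ)
    (p := a) (q := q) (c := 3 / 2) (k₀ := k₀)
    (K := B / lam * (∑ i ∈ Finset.Icc 1 N, A i) + M / lam ^ 2)
    (hq0.trans_le hqa) ha1 hq0 (by linarith) fun k hk => by
      have hk1 := hk₀.trans hk
      have hkp : (0 : ℝ) < k := by exact_mod_cast hk1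
      have hx0 : 0 < (k : ℝ) ^ (-a) := Real.rpow_pos_of_pos hkp _
      have hxy : (k : ℝ) ^ (-a) ≤ (k : ℝ) ^ (-q) :=
        Real.rpow_le_rpow_of_exponent_le (by exact_mod_cast hk1) (by linarith)
      have hlα : lam * α k = (k : ℝ) ^ (-a) := by rw [hα k hk1]; field_simp
      have hα0 : 0 ≤ α k := by rw [hα k hk1]; positivity
      have hsum : HasMeanLE μ (fun o => ∑ i ∈ Finset.Icc 1 N,
          ‖y i k o - O.f i (y (i + 1) k o)‖ ^ 2) ((∑ i ∈ Finset.Icc 1 N, A i) * (k : ℝ) ^ (-q)) := by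
        refine ⟨integrable_finsetSum _ fun i hi => hδi i hi k, ?_⟩
        rw [integral_finsetSum _ fun i hi => hδi i hi k, Finset.sum_mul]
        exact Finset.sum_le_sum fun i hi => hδ i hi k hk1
      have hg := ((HasMeanLE.const_mul (t := 1 - 3 / 2 * (lam * α k)) ⟨(hbound k).1, le_rfl⟩
        (by rw [hlα]; linarith [hsmall k hk])).add
        (hsum.const_mul (mul_nonneg hB hα0))).add (hasMeanLE_const (M * α k ^ 2))
      have hopt := hb.measurable_optProj hconv
      have m1 : Measurable fun p : (∀ j, E d j) × SamplePath W => p.1 (N + 1) :=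
        (measurable_pi_apply _).comp measurable_fst
      have step := hr.hasMeanLE_main hb hs hy k
        (h := fun y w => ‖y (N + 1) - optProj O N X (y (N + 1))
          - α k • quasiGrad O w y (N + 1)‖ ^ 2)
        (g := fun y => (1 - 3 / 2 * (lam * α k)) * ‖y (N + 1) - optProj O N X (y (N + 1))‖ ^ 2
          + B * α k * (∑ i ∈ Finset.Icc 1 N, ‖y i - O.f i (y (i + 1))‖ ^ 2) + M * α k ^ 2)
        (((m1.sub (hopt.comp m1)).sub
          (measurable_quasiGrad_state.const_smul (α k))).norm.pow_const 2)
        (fun _ _ => by positivity) (fun y hyX => hmain (α k) y hα0 hyX) hg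
      -- The old nearest optimal point is a competitor for the new one, and it lies in `X`, so
      -- projecting the step onto `X` does not increase the distance to it.
      have hnext := step.of_le (hbound (k + 1)).1.1
        (Filter.Eventually.of_forall fun o => by positivity)
        (Filter.Eventually.of_forall fun o => by
          have hp := hb.optProj_mem (y (N + 1) k o)
          refine pow_le_pow_left₀ (norm_nonneg _) ((norm_sub_proj_le hb.exists_optimal
            (isClosed_optimalSet hb.closed hb.continuous_objective) _ hp).trans ?_) 2
          have h1 := norm_proj_sub_proj_le ⟨_, hp.1⟩ hb.closed hb.convex
            (y (N + 1) k o - α k • quasiGrad O (s k (N + 1) o) (fun j => y j k o) (N + 1))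
            (optProj O N X (y (N + 1) k o))
          rw [proj_eq_self hb.closed hp.1, ← hr.main, sub_right_comm] at h1
          exact h1)
      refine hnext.2.trans ?_
      have hαk : α k = (k : ℝ) ^ (-a) / lam := by rw [← hlα]; field_simp
      have e1 : M * α k ^ 2 ≤ M / lam ^ 2 * ((k : ℝ) ^ (-a) * (k : ℝ) ^ (-q)) := by
        rw [hαk]
        calc _ = M / lam ^ 2 * ((k : ℝ) ^ (-a) * (k : ℝ) ^ (-a)) := by ring
          _ ≤ _ := by gcongr
      have e2 : B * α k * ((∑ i ∈ Finset.Icc 1 N, A i) * (k : ℝ) ^ (-q))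
          = B / lam * (∑ i ∈ Finset.Icc 1 N, A i) * ((k : ℝ) ^ (-a) * (k : ℝ) ^ (-q)) := by
        rw [hαk]; ring
      rw [hlα, e2]
      linarith
  exact ⟨K', fun n hn => ⟨(hbound n).1, hK' n hn⟩⟩

/-- The exponents of the terms of `generalRate`. -/
noncomputable def rateExponents (N : ℕ) (a : ℝ) (b : ℕ → ℝ) : Finset ℝ :=
  if N = 0 then {a} else
    {a, 2 * (a - b N), b N} ∪ ((Finset.Ico 1 N).image (fun j => 4 * (b (j + 1) - b j))
      ∪ (Finset.Ico 1 N).image b)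

theorem rpow_le_generalRate {N : ℕ} {a q : ℝ} {b : ℕ → ℝ} (hq : q ∈ rateExponents N a b) (n : ℕ) :
    (n : ℝ) ^ (-q) ≤ generalRate N a b n := by
  have hp : ∀ r : ℝ, 0 ≤ (n : ℝ) ^ r := fun r => Real.rpow_nonneg (Nat.cast_nonneg n) r
  unfold rateExponents at hq
  unfold generalRate
  split_ifs at hq ⊢ with hN
  · simp_all
  · have hs : ∀ j ∈ Finset.Ico 1 N,
        0 ≤ (n : ℝ) ^ (-(4 * (b (j + 1) - b j))) + (n : ℝ) ^ (-b j) :=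
      fun j _ => add_nonneg (hp _) (hp _)
    have hsum := Finset.sum_nonneg hs
    have h1 := hp (-a)
    have h2 := hp (-(2 * (a - b N)))
    have h3 := hp (-b N)
    simp only [Finset.mem_union, Finset.mem_insert, Finset.mem_singleton, Finset.mem_image] at hq
    rcases hq with (rfl | rfl | rfl) | ⟨j, hj, rfl⟩ | ⟨j, hj, rfl⟩
    · linarith
    · linarith
    · linarith
    · linarith [Finset.single_le_sum hs hj, hp (-b j)]
    · linarith [Finset.single_le_sum hs hj, hp (-(4 * (b (j + 1) - b j)))]

theorem MeanSquareRate.of_le {H : Type*} [NormedAddCommGroup H] {S : Set H} {x : ℕ → Ω → H}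
    {r r' : ℕ → ℝ} (h : MeanSquareRate μ S x r) (hr : ∀ n : ℕ, 1 ≤ n → r n ≤ r' n)
    (hr0 : ∀ n : ℕ, 1 ≤ n → 0 ≤ r n) : MeanSquareRate μ S x r' := by
  obtain ⟨K, hK⟩ := h
  refine ⟨max K 0, fun n hn => ⟨(hK n hn).1, (hK n hn).2.trans ?_⟩⟩
  exact mul_le_mul (le_max_left _ _) (hr n hn) (hr0 n hn) (le_max_right _ _)

/-- The sum is at least the power with the smallest exponent `q`. If `q ≤ 0`, boundedness of the
distances suffices; if `q > 0`, minimality of `q` supplies all the admissibility conditions,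
including that the exponents increase strictly with the level. -/
theorem IsRun.meanSquareRate_generalRate (hr : IsRun O N X s false α β y)
    (hb : BasicAssumption O N X P C V L) (h4 : FourthMomentAssumption O N X P C V)
    (hs : SamplePaths μ (N + 1) P s) (hconv : ConvexOn ℝ X (objective O (N + 1))) {lam : ℝ}
    (hlam : OptimallyStronglyConvex X (objective O (N + 1)) lam) {a : ℝ} {b : ℕ → ℝ} (ha : a ≤ 1)
    (hst : PolynomialSteps N lam 1 a b α β) :
    MeanSquareRate μ (optimalSet X (objective O (N + 1))) (y (N + 1)) (generalRate N a b) := by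
  have hne : (rateExponents N a b).Nonempty := by
    unfold rateExponents
    split_ifs <;> exact ⟨a, by simp⟩
  obtain ⟨q, hq, hmin⟩ := Finset.exists_min_image _ id hne
  refine MeanSquareRate.of_le ?_ (fun n _ => rpow_le_generalRate hq n)
    fun n _ => Real.rpow_nonneg (Nat.cast_nonneg n) _
  rcases le_or_gt q 0 with hq0 | hq0
  · obtain ⟨D, hD, hbound⟩ := hr.exists_bound hb hs hconv hlam
    refine ⟨D, fun n hn => ⟨(hbound n).1, (hbound n).2.trans (le_mul_of_one_le_right hD ?_)⟩⟩
    exact Real.one_le_rpow (by exact_mod_cast hn) (by linarith)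
  -- The exponent `a` of the main stepsize is placed at index `N + 1`, where `AdmissibleExponents`
  -- expects it.
  have hb' : ∀ j ∈ Set.Icc 1 N, Function.update b (N + 1) a j = b j := fun j hj =>
    Function.update_of_ne (by have := hj.2; omega) _ _
  refine hr.meanSquareRate hb h4 (fun h => by simp at h) hs hconv hlam
    (b := Function.update b (N + 1) a) (c := fun j => if j = N then 1 else 2) ?_ hst.beta_zero
    (fun j _ => by split_ifs <;> norm_num) (fun j hj k hk => ?_) ?_
  · simpa using hst.alpha
  · rw [hb' j hj]
    split_ifs with hjN
    · subst hjN
      exact hst.beta_inner hj.1 k hk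
    · exact hst.beta_outer j ⟨hj.1, lt_of_le_of_ne hj.2 hjN⟩ k hk
  · have hmem : ∀ r, r ∈ rateExponents N a b → q ≤ r := hmin
    unfold rateExponents at hmem
    refine ⟨hq0, fun j hj => ?_, by simpa using ha, fun hN _ => ?_, fun j hj hc => ?_⟩
    · rcases hj.2.lt_or_eq with hlt | rfl
      · have hjN : j ∈ Set.Icc 1 N := ⟨hj.1, by omega⟩
        rw [hb' j hjN]
        refine hmem _ ?_
        rw [if_neg (by have := hj.1; omega)]
        rcases hjN.2.lt_or_eq with hlt' | rfl
        · exact Finset.mem_union_right _ (Finset.mem_union_right _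
            (Finset.mem_image_of_mem b (Finset.mem_Ico.2 ⟨hj.1, hlt'⟩)))
        · simp
      · rw [Function.update_self]
        refine hmem _ ?_
        split_ifs <;> simp
    · rw [Function.update_self, hb' N ⟨hN, le_rfl⟩]
      refine hmem _ ?_
      rw [if_neg (by omega)]
      simp
    · have hlt : j < N := lt_of_le_of_ne hj.2 fun h => hc ⟨h, rfl⟩
      rw [hb' j hj, hb' (j + 1) ⟨by omega, hlt⟩]
      refine hmem _ ?_
      rw [if_neg (by omega)]
      exact Finset.mem_union_right _ (Finset.mem_union_left _ (Finset.mem_image_of_mem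
        (fun j => 4 * (b (j + 1) - b j)) (Finset.mem_Ico.2 ⟨hj.1, hlt⟩)))

/-- The exponents balance the constraints at `q = 4 / D`: the smallest is `4 / D`, and consecutive
gaps are `1 / D`. The last gap `1 - (3 + N) / D` is `1 / D` with extrapolation, counted four times,
and `2 / D` without, counted twice. -/
theorem IsRun.meanSquareRate_of_steps (hr : IsRun O N X s smoothInner α β y)
    (hb : BasicAssumption O N X P C V L) (h4 : FourthMomentAssumption O N X P C V)
    (hsm : smoothInner = true → SmoothInnerAssumption O N P V L)
    (hs : SamplePaths μ (N + 1) P s) (hconv : ConvexOn ℝ X (objective O (N + 1))) {lam : ℝ}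
    (hlam : OptimallyStronglyConvex X (objective O (N + 1)) lam) {c D : ℝ} (hc : 1 ≤ c)
    (hD : D = (if smoothInner then 4 else 5) + (N : ℝ))
    (hst : PolynomialSteps N lam c 1 (fun j => (3 + j) / D) α β) :
    MeanSquareRate μ (optimalSet X (objective O (N + 1))) (y (N + 1))
      (fun n => (n : ℝ) ^ (-4 / D)) := by
  have hN0 : (0 : ℝ) ≤ N := Nat.cast_nonneg N
  have hD4 : 4 + (N : ℝ) ≤ D := by rw [hD]; split_ifs <;> linarith
  have hDp : 0 < D := by linarith
  have hb' : ∀ j ∈ Set.Icc 1 N,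
      Function.update (fun j : ℕ => (3 + (j : ℝ)) / D) (N + 1) 1 j = (3 + (j : ℝ)) / D :=
    fun j hj => Function.update_of_ne (by have := hj.2; omega) _ _
  have hmsr := hr.meanSquareRate hb h4 hsm hs hconv hlam (q := 4 / D)
    (b := Function.update (fun j : ℕ => (3 + (j : ℝ)) / D) (N + 1) 1)
    (c := fun j => if j = N then c else 2) ?_ hst.beta_zero
    (fun j _ => by split_ifs <;> linarith) (fun j hj k hk => ?_) ?_
  · simpa only [neg_div] using hmsr
  · simpa using hst.alpha
  · rw [hb' j hj]
    split_ifs with hjN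
    · subst hjN
      exact hst.beta_inner hj.1 k hk
    · exact hst.beta_outer j ⟨hj.1, lt_of_le_of_ne hj.2 hjN⟩ k hk
  · refine ⟨by positivity, fun j hj => ?_, by simp, fun hN hsi => ?_, fun j hj hcase => ?_⟩
    · rcases hj.2.lt_or_eq with hlt | rfl
      · rw [hb' j ⟨hj.1, by omega⟩]
        have : (1 : ℝ) ≤ j := by exact_mod_cast hj.1
        gcongr
        linarith
      · rw [Function.update_self, div_le_one hDp]
        linarith
    · rw [Function.update_self, hb' N ⟨hN, le_rfl⟩]
      have hD5 : D = 5 + (N : ℝ) := by simpa [hsi] using hD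
      rw [one_sub_div hDp.ne', ← mul_div_assoc]
      gcongr
      linarith
    · rw [hb' j hj]
      rcases hj.2.lt_or_eq with hlt | rfl
      · rw [hb' (j + 1) ⟨by omega, hlt⟩, ← sub_div, ← mul_div_assoc]
        gcongr
        push_cast
        linarith
      · rw [Function.update_self, one_sub_div hDp.ne', ← mul_div_assoc]
        gcongr
        linarith

end Convergence

end TSCGD

open TSCGD
theorem theorem3p3
    {d : ℕ → ℕ} {W : ℕ → Type*} [∀ j, MeasurableSpace (W j)]
    {Ω : Type*} [MeasurableSpace Ω] (μ : Measure Ω) [IsProbabilityMeasure μ]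
    (O : Oracle d W) (N T : ℕ) (hT : T = N + 1) (X : Set (E d (N + 1)))
    (P : Measure (SamplePath W)) [IsProbabilityMeasure P] (C V L : ℕ → ℝ)
    (hbasic : BasicAssumption O N X P C V L)
    (hsmooth : SmoothObjective (objective O (N + 1)))
    (hfourth : FourthMomentAssumption O N X P C V)
    (hconvex : ConvexOn ℝ X (objective O (N + 1)))
    (lam : ℝ) (hlam : OptimallyStronglyConvex X (objective O (N + 1)) lam)
    (s : ℕ → ℕ → Ω → SamplePath W) (hs : SamplePaths μ (N + 1) P s) :
    -- the basic update at the innermost level, general exponents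
    (∀ (a : ℝ) (b : ℕ → ℝ) (α : ℕ → ℝ) (β : ℕ → ℕ → ℝ) (y : ∀ j, ℕ → Ω → E d j),
      a ≤ 1 → PolynomialSteps N lam 1 a b α β → IsRun O N X s false α β y →
      MeanSquareRate μ (optimalSet X (objective O (N + 1))) (y (N + 1)) (generalRate N a b)) ∧
    -- the basic update at the innermost level, optimized exponents
    (∀ (α : ℕ → ℝ) (β : ℕ → ℕ → ℝ) (y : ∀ j, ℕ → Ω → E d j),
      PolynomialSteps N lam 1 1 (fun j => (3 + j) / (4 + T)) α β → IsRun O N X s false α β y →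
      MeanSquareRate μ (optimalSet X (objective O (N + 1))) (y (N + 1))
        (fun n => (n : ℝ) ^ (-4 / (4 + T) : ℝ))) ∧
    -- a smooth innermost level
    (SmoothInnerAssumption O N P V L →
      ∀ (α : ℕ → ℝ) (β : ℕ → ℕ → ℝ) (y : ∀ j, ℕ → Ω → E d j),
      PolynomialSteps N lam 2 1 (fun j => (3 + j) / (3 + T)) α β → IsRun O N X s true α β y →
      MeanSquareRate μ (optimalSet X (objective O (N + 1))) (y (N + 1))
        (fun n => (n : ℝ) ^ (-4 / (3 + T) : ℝ))) := by
  have hTR : (T : ℝ) = N + 1 := by rw [hT]; push_cast; rfl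
  refine ⟨fun a b α β y ha hst hr =>
    hr.meanSquareRate_generalRate hbasic hfourth hs hconvex hlam ha hst,
    fun α β y hst hr => ?_, fun hsm α β y hst hr => ?_⟩
  · exact hr.meanSquareRate_of_steps hbasic hfourth (fun h => by simp at h) hs hconvex hlam le_rfl
      (by rw [hTR]; simp only [Bool.false_eq_true, if_false]; ring) hst
  · exact hr.meanSquareRate_of_steps hbasic hfourth (fun _ => hsm) hs hconvex hlam one_le_two
      (by rw [hTR]; simp only [if_true]; ring) hst
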